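/- **Setting.** Fix countably infinitely many unary predicate symbols $p$, binary relation symbols $a$, and function symbols of each arity (constants are the nullary ones). Formulas of transitive closure logic are generated by $$p(t)\mid \bar p(t)\mid a(s,t)\mid \bar a(s,t)\mid s=t\mid s\neq t\mid A\wedge B\mid A\vee B\mid \forall xA\mid \exists xA\mid TC(\lambda x,y.A)(s,t)\mid \overline{TC}(\lambda x,y.A)(s,t),$$ and $\bar A$ denotes the De Morgan dual of $A$ (with $TC$ and $\overline{TC}$ dual to each other). A sequent is a finite set of closed formulas; $\Gamma,A$ stands for $\Gamma\cup\{A\}$. The system $\mathsf{TCL}_G$ has the following rules (all terms closed): * axioms $\Gamma,p(t),\bar p(t)$; $\ \Gamma,a(s,t),\bar a(s,t)$; $\ \Gamma,t=t$; * from $\Gamma,A_i$ infer $\Gamma,A_0\vee A_1$ ($i\in\{0,1\}$); from $\Gamma,A$ and $\Gamma,B$ infer $\Gamma,A\wedge B$; * from $\Gamma,A(t)$ infer $\Gamma,\exists xA(x)$; from $\Gamma,A(c)$ infer $\Gamma,\forall xA(x)$, where $c$ is a constant that does not occur in the conclusion; * from $\Gamma$ infer $\Gamma,\Gamma'$; from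 $\Gamma,A(t)$ infer $\Gamma,s\ne t,A(s)$; from $\Gamma,A(s)$ infer $\Gamma,s\neq t,A(t)$; * from $\Gamma$ infer $\sigma(\Gamma)$, where $\sigma$ maps constants to closed terms and other function symbols to function symbols of the same arity; * from $\Gamma,A(s,t)$ infer $\Gamma,TC(A)(s,t)$; from $\Gamma,A(s,r)$ and $\Gamma,TC(A)(r,t)$ infer $\Gamma,TC(A)(s,t)$; * from $\Gamma,A(s,t)$ and $\Gamma,A(s,c),\overline{TC}(A)(c,t)$ infer $\Gamma,\overline{TC}(A)(s,t)$, where $c$ is a constant that does not occur in the conclusion. The cut rule (not a rule of $\mathsf{TCL}_G$) infers $\Gamma$ from $\Gamma,A$ and $\Gamma,\bar A$. A preproof is a possibly infinite tree of rule instances; it is regular if it has only finitely many distinct subtrees. A trace along an infinite branch is a sequence $(\varphi_i)_{i\ge k}$ of formulas $\varphi_i=\overline{TC}(A_i)(s_i,t_i)$, with $\varphi_i$ in the $i$-th sequent of the branch, such that for each $i\geq k$ one of the following holds: the $i$-th step is not a substitution step and $\varphi_{i+1}=\varphi_i$; or the $i$-th step is a $\overline{TC}$ step with principal formula $\varphi_i$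 and eigenvariable $c$, the branch follows its right premiss, and $\varphi_{i+1}=\overline{TC}(A_i)(c,t_i)$; or the $i$-th step is a substitution step for $\sigma$ and $\sigma(\varphi_{i+1})=\varphi_i$. The trace is progressing if the second case happens infinitely often. A cyclic proof (with or without cut) is a regular preproof (with or without instances of cut) each of whose infinite branches has a progressing trace. **Statement.** The class of cyclic proofs of $\mathsf{TCL}_G$ does not enjoy cut-admissibility: 1. there is a closed formula $A$ that has a cyclic proof in $\mathsf{TCL}_G$ with cut, but no cyclic proof in $\mathsf{TCL}_G$ (without cut); 2. the class of sequents that have cyclic proofs in $\mathsf{TCL}_G$ (without cut) is not closed under the cut rule: there are a sequent $\Gamma$ and a closed formula $A$ such that $\Gamma,A$ and $\Gamma,\bar A$ have cyclic proofs in $\mathsf{TCL}_G$, but $\Gamma$ has none. -/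

import Mathlib

noncomputable section

namespace TCL

open FirstOrder

/-! ## Syntax -/

/-- The fixed vocabulary: countably many function symbols of every arity (those of arity `0` are the
constants), countably many unary predicate symbols and countably many binary relation symbols. -/
abbrev vocab : Language where
  Functions := fun _ => ℕ
  Relations := fun k => match k with
    | 1 => ℕ
    | 2 => ℕ
    | _ => Empty

/-- Terms whose variables are among `n` given ones; `Tm 0` is the type of closed terms. -/
abbrev Tm (n : ℕ) : Type := vocab.Term (Fin n)

/-- The constant symbol number `c`, as a term. -/
def Tm.cst {n : ℕ} (c : ℕ) : Tm n :=
  @Language.Term.func vocab (Fin n) 0 c Fin.elim0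

/-- A term in `n` variables, seen as a term in `n + 1` variables (the new variable is the last
one). -/
def Tm.weaken {n : ℕ} (t : Tm n) : Tm (n + 1) := t.relabel Fin.castSucc

/-- Formulas of transitive closure logic with equality in negation normal form, with free variables
among `n` given ones. A quantifier binds the variable number `n`; the operators `tc` and `cotc` bind
the variables number `n` and `n + 1`, so that `tc A s t` is `TC(λ x y. A)(s, t)`, where `x` is the
variable number `n` and `y` is the variable number `n + 1`, and `cotc A s t` is the dual formula. -/
inductive Form : ℕ → Type
  /-- `p(t)` -/
  | pred {n : ℕ} (p : vocab.Relations 1) (t : Tm n) : Form n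
  /-- the complement of `p(t)` -/
  | npred {n : ℕ} (p : vocab.Relations 1) (t : Tm n) : Form n
  /-- `a(s, t)` -/
  | rel {n : ℕ} (a : vocab.Relations 2) (s t : Tm n) : Form n
  /-- the complement of `a(s, t)` -/
  | nrel {n : ℕ} (a : vocab.Relations 2) (s t : Tm n) : Form n
  /-- `s = t` -/
  | eq {n : ℕ} (s t : Tm n) : Form n
  /-- `s ≠ t` -/
  | neq {n : ℕ} (s t : Tm n) : Form n
  | and {n : ℕ} (A B : Form n) : Form n
  | or {n : ℕ} (A B : Form n) : Form n
  | all {n : ℕ} (A : Form (n + 1)) : Form n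
  | ex {n : ℕ} (A : Form (n + 1)) : Form n
  | tc {n : ℕ} (A : Form (n + 2)) (s t : Tm n) : Form n
  | cotc {n : ℕ} (A : Form (n + 2)) (s t : Tm n) : Form n

/-- Closed formulas. -/
abbrev Sentence : Type := Form 0

namespace Form

/-- The complement (De Morgan dual) of a formula. -/
def compl : {n : ℕ} → Form n → Form n
  | _, pred p t => npred p t
  | _, npred p t => pred p t
  | _, rel a s t => nrel a s t
  | _, nrel a s t => rel a s t
  | _, eq s t => neq s t
  | _, neq s t => eq s t
  | _, and A B => or A.compl B.compl
  | _, or A B => and A.compl B.compl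
  | _, all A => ex A.compl
  | _, ex A => all A.compl
  | _, tc A s t => cotc A.compl s t
  | _, cotc A s t => tc A.compl s t

/-- A simultaneous substitution for `n` variables, extended under a binder. -/
def lift {n m : ℕ} (τ : Fin n → Tm m) : Fin (n + 1) → Tm (m + 1) :=
  Fin.snoc (α := fun _ => Tm (m + 1)) (fun i => (τ i).weaken) (Language.Term.var (Fin.last m))

/-- Capture-avoiding simultaneous substitution of terms for variables. -/
def inst : {n m : ℕ} → Form n → (Fin n → Tm m) → Form m
  | _, _, pred p t, τ => pred p (t.subst τ)
  | _, _, npred p t, τ => npred p (t.subst τ)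
  | _, _, rel a s t, τ => rel a (s.subst τ) (t.subst τ)
  | _, _, nrel a s t, τ => nrel a (s.subst τ) (t.subst τ)
  | _, _, eq s t, τ => eq (s.subst τ) (t.subst τ)
  | _, _, neq s t, τ => neq (s.subst τ) (t.subst τ)
  | _, _, and A B, τ => and (A.inst τ) (B.inst τ)
  | _, _, or A B, τ => or (A.inst τ) (B.inst τ)
  | _, _, all A, τ => all (A.inst (lift τ))
  | _, _, ex A, τ => ex (A.inst (lift τ))
  | _, _, tc A s t, τ => tc (A.inst (lift (lift τ))) (s.subst τ) (t.subst τ)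
  | _, _, cotc A s t, τ => cotc (A.inst (lift (lift τ))) (s.subst τ) (t.subst τ)

end Form

/-- The constant `c` occurs in a term. -/
def Tm.HasConst {n : ℕ} (c : ℕ) : Tm n → Prop
  | .var _ => False
  | @Language.Term.func _ _ 0 d _ => d = c
  | @Language.Term.func _ _ (_ + 1) _ ts => ∃ i, Tm.HasConst c (ts i)

/-- The constant `c` occurs in a formula. -/
def Form.HasConst (c : ℕ) : {n : ℕ} → Form n → Prop
  | _, .pred _ t => t.HasConst c
  | _, .npred _ t => t.HasConst c
  | _, .rel _ s t => s.HasConst c ∨ t.HasConst c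
  | _, .nrel _ s t => s.HasConst c ∨ t.HasConst c
  | _, .eq s t => s.HasConst c ∨ t.HasConst c
  | _, .neq s t => s.HasConst c ∨ t.HasConst c
  | _, .and A B => A.HasConst c ∨ B.HasConst c
  | _, .or A B => A.HasConst c ∨ B.HasConst c
  | _, .all A => A.HasConst c
  | _, .ex A => A.HasConst c
  | _, .tc A s t => A.HasConst c ∨ s.HasConst c ∨ t.HasConst c
  | _, .cotc A s t => A.HasConst c ∨ s.HasConst c ∨ t.HasConst c

/-- A substitution of symbols: constants are mapped to closed terms, and function symbols of arity
`k + 1` are mapped to function symbols of the same arity. -/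
structure SymSubst : Type where
  /-- the image of a constant -/
  onConst : vocab.Functions 0 → Tm 0
  /-- the image of a function symbol of positive arity -/
  onFun : (k : ℕ) → vocab.Functions (k + 1) → vocab.Functions (k + 1)

/-- A substitution of symbols, acting on terms. -/
def SymSubst.onTm (σ : SymSubst) {n : ℕ} : Tm n → Tm n
  | .var i => .var i
  | @Language.Term.func _ _ 0 c _ => (σ.onConst c).relabel Fin.elim0
  | @Language.Term.func _ _ (k + 1) f ts => .func (σ.onFun k f) fun i => σ.onTm (ts i)

/-- A substitution of symbols, acting on formulas. -/
def SymSubst.onForm (σ : SymSubst) : {n : ℕ} → Form n → Form n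
  | _, .pred p t => .pred p (σ.onTm t)
  | _, .npred p t => .npred p (σ.onTm t)
  | _, .rel a s t => .rel a (σ.onTm s) (σ.onTm t)
  | _, .nrel a s t => .nrel a (σ.onTm s) (σ.onTm t)
  | _, .eq s t => .eq (σ.onTm s) (σ.onTm t)
  | _, .neq s t => .neq (σ.onTm s) (σ.onTm t)
  | _, .and A B => .and (σ.onForm A) (σ.onForm B)
  | _, .or A B => .or (σ.onForm A) (σ.onForm B)
  | _, .all A => .all (σ.onForm A)
  | _, .ex A => .ex (σ.onForm A)
  | _, .tc A s t => .tc (σ.onForm A) (σ.onTm s) (σ.onTm t)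
  | _, .cotc A s t => .cotc (σ.onForm A) (σ.onTm s) (σ.onTm t)

/-! ## The sequent calculus -/

instance : DecidableEq Sentence := Classical.decEq _

/-- A sequent is a finite set of closed formulas, read disjunctively. Since `Γ, A` is the set
`insert A Γ`, in which `A` may already be an element of `Γ`, contraction is built in. -/
abbrev Sequent : Type := Finset Sentence

/-- Instances of inference rules. The context `Γ` and the other data determine the conclusion
`Step.concl` and the list of premisses `Step.prems`. -/
inductive Step : Type
  /-- `Γ, p(t), p̄(t)` -/
  | idPred (Γ : Sequent) (p : vocab.Relations 1) (t : Tm 0)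
  /-- `Γ, a(s, t), ā(s, t)` -/
  | idRel (Γ : Sequent) (a : vocab.Relations 2) (s t : Tm 0)
  /-- from `Γ, A` infer `Γ, A ∨ B` -/
  | orLeft (Γ : Sequent) (A B : Sentence)
  /-- from `Γ, B` infer `Γ, A ∨ B` -/
  | orRight (Γ : Sequent) (A B : Sentence)
  /-- from `Γ, A` and `Γ, B` infer `Γ, A ∧ B` -/
  | and (Γ : Sequent) (A B : Sentence)
  /-- from `Γ, A(t)` infer `Γ, ∃ x A(x)` -/
  | ex (Γ : Sequent) (A : Form 1) (t : Tm 0)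
  /-- from `Γ, A(c)` infer `Γ, ∀ x A(x)`, for a fresh constant `c` -/
  | all (Γ : Sequent) (A : Form 1) (c : ℕ)
  /-- from `Γ` infer `Γ, Γ'` -/
  | wk (Γ Γ' : Sequent)
  /-- `Γ, t = t` -/
  | refl (Γ : Sequent) (t : Tm 0)
  /-- from `Γ, A(t)` infer `Γ, s ≠ t, A(s)` -/
  | neqLeft (Γ : Sequent) (s t : Tm 0) (A : Form 1)
  /-- from `Γ, A(s)` infer `Γ, s ≠ t, A(t)` -/
  | neqRight (Γ : Sequent) (s t : Tm 0) (A : Form 1)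
  /-- from `Γ` infer `σ(Γ)` -/
  | subst (σ : SymSubst) (Γ : Sequent)
  /-- from `Γ, A(s, t)` infer `Γ, TC(A)(s, t)` -/
  | tcBase (Γ : Sequent) (A : Form 2) (s t : Tm 0)
  /-- from `Γ, A(s, r)` and `Γ, TC(A)(r, t)` infer `Γ, TC(A)(s, t)` -/
  | tcStep (Γ : Sequent) (A : Form 2) (s t r : Tm 0)
  /-- from `Γ, A(s, t)` and `Γ, A(s, c), coTC(A)(c, t)` infer `Γ, coTC(A)(s, t)`, for a fresh
  constant `c` -/
  | cotc (Γ : Sequent) (A : Form 2) (s t : Tm 0) (c : ℕ)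
  /-- the cut rule: from `Γ, A` and `Γ, Ā` infer `Γ` -/
  | cut (Γ : Sequent) (A : Sentence)

namespace Step

/-- The conclusion of a rule instance. -/
def concl : Step → Sequent
  | idPred Γ p t => insert (.pred p t) (insert (.npred p t) Γ)
  | idRel Γ a s t => insert (.rel a s t) (insert (.nrel a s t) Γ)
  | orLeft Γ A B => insert (.or A B) Γ
  | orRight Γ A B => insert (.or A B) Γ
  | and Γ A B => insert (.and A B) Γ
  | ex Γ A _ => insert (.ex A) Γ
  | all Γ A _ => insert (.all A) Γ
  | wk Γ Γ' => Γ ∪ Γ'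
  | refl Γ t => insert (.eq t t) Γ
  | neqLeft Γ s t A => insert (.neq s t) (insert (A.inst ![s]) Γ)
  | neqRight Γ s t A => insert (.neq s t) (insert (A.inst ![t]) Γ)
  | subst σ Γ => Γ.image σ.onForm
  | tcBase Γ A s t => insert (.tc A s t) Γ
  | tcStep Γ A s t _ => insert (.tc A s t) Γ
  | cotc Γ A s t _ => insert (.cotc A s t) Γ
  | cut Γ _ => Γ

/-- The premisses of a rule instance, from left to right. -/
def prems : Step → List Sequent
  | idPred _ _ _ => []
  | idRel _ _ _ _ => []
  | orLeft Γ A _ => [insert A Γ]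
  | orRight Γ _ B => [insert B Γ]
  | and Γ A B => [insert A Γ, insert B Γ]
  | ex Γ A t => [insert (A.inst ![t]) Γ]
  | all Γ A c => [insert (A.inst ![Tm.cst c]) Γ]
  | wk Γ _ => [Γ]
  | refl _ _ => []
  | neqLeft Γ _ t A => [insert (A.inst ![t]) Γ]
  | neqRight Γ s _ A => [insert (A.inst ![s]) Γ]
  | subst _ Γ => [Γ]
  | tcBase Γ A s t => [insert (A.inst ![s, t]) Γ]
  | tcStep Γ A s t r => [insert (A.inst ![s, r]) Γ, insert (.tc A r t) Γ]
  | cotc Γ A s t c =>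
      [insert (A.inst ![s, t]) Γ,
        insert (A.inst ![s, Tm.cst c]) (insert (.cotc A (Tm.cst c) t) Γ)]
  | cut Γ A => [insert A Γ, insert A.compl Γ]

/-- The side conditions: the eigenvariable of an `all` or `cotc` step is fresh, that is, it does not
occur in the conclusion. -/
def SideCond : Step → Prop
  | all Γ A c => ∀ B ∈ (all Γ A c).concl, ¬ B.HasConst c
  | cotc Γ A s t c => ∀ B ∈ (cotc Γ A s t c).concl, ¬ B.HasConst c
  | _ => True

/-- The rule instance is a cut. -/
def IsCut (r : Step) : Prop := ∃ Γ A, r = cut Γ A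

/-- The rule instance is a substitution step. -/
def IsSubst (r : Step) : Prop := ∃ σ Γ, r = subst σ Γ

end Step

/-! ## Preproofs -/

/-- The shape of preproofs: a node carries a rule instance and has one child for each premiss. -/
abbrev stepShape : PFunctor.{0, 0} := ⟨Step, fun r => Fin r.prems.length⟩

/-- Possibly infinite trees of rule instances (the coinductive type of all such trees). -/
abbrev Tree : Type := stepShape.M

namespace Tree

/-- The rule instance at the root. -/
def root (D : Tree) : Step := PFunctor.M.head D

/-- The immediate subtree above the premiss number `j` of the root. -/
def child (D : Tree) (j : Fin D.root.prems.length) : Tree := PFunctor.M.children D j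

/-- `S` is a subtree of `D`. -/
inductive IsSubtree (D : Tree) : Tree → Prop
  | self : IsSubtree D D
  | child (S : Tree) (j : Fin S.root.prems.length) : IsSubtree D S → IsSubtree D (S.child j)

/-- Preproofs: at every node the side conditions hold, and the conclusion of each child is the
corresponding premiss. -/
def IsPreproof (D : Tree) : Prop :=
  ∀ S, D.IsSubtree S →
    S.root.SideCond ∧ ∀ j, (S.child j).root.concl = S.root.prems.get j

/-- There are only finitely many distinct subtrees. -/
def IsRegular (D : Tree) : Prop := {S | D.IsSubtree S}.Finite

/-- No cut is used. -/
def CutFree (D : Tree) : Prop := ∀ S, D.IsSubtree S → ¬ S.root.IsCut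

/-- An infinite branch of `D`: the subtree `node i` reached after `i` steps, and the premiss `dir i`
that the branch follows there. -/
structure Branch (D : Tree) : Type where
  /-- the subtrees along the branch -/
  node : ℕ → Tree
  /-- the premisses that are followed -/
  dir : ∀ i, Fin (node i).root.prems.length
  node_zero : node 0 = D
  node_succ : ∀ i, node (i + 1) = (node i).child (dir i)

end Tree

/-- The formula is of the form `coTC(A)(s, t)`. -/
def IsCotc (φ : Sentence) : Prop := ∃ A s t, φ = .cotc A s t

/-- A step of a trace from the conclusion of `r` to its premiss number `j` that is principal: `r`
unfolds `φ = coTC(A)(s, t)`, the right premiss is followed, and the trace goes on with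
`ψ = coTC(A)(c, t)`, where `c` is the eigenvariable of `r`. -/
def TraceProgress (r : Step) (j : Fin r.prems.length) (φ ψ : Sentence) : Prop :=
  ∃ Γ A s t c, r = .cotc Γ A s t c ∧ j.val = 1 ∧
    φ = .cotc A s t ∧ ψ = .cotc A (Tm.cst c) t

/-- A step of a trace from `φ` in the conclusion of `r` to `ψ` in its premiss number `j`. -/
def TraceStep (r : Step) (j : Fin r.prems.length) (φ ψ : Sentence) : Prop :=
  (¬ r.IsSubst ∧ ψ = φ) ∨ TraceProgress r j φ ψ ∨ (∃ σ Γ, r = .subst σ Γ ∧ σ.onForm ψ = φ)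

/-- `φ`, restricted to the indices `i ≥ k`, is a trace along the branch. -/
def IsTrace {D : Tree} (b : D.Branch) (k : ℕ) (φ : ℕ → Sentence) : Prop :=
  ∀ i, k ≤ i → IsCotc (φ i) ∧ φ i ∈ (b.node i).root.concl ∧
    TraceStep (b.node i).root (b.dir i) (φ i) (φ (i + 1))

/-- The branch has a trace that progresses infinitely often. -/
def HasProgressingTrace {D : Tree} (b : D.Branch) : Prop :=
  ∃ k φ, IsTrace b k φ ∧
    ∀ m, ∃ i, m ≤ i ∧ k ≤ i ∧ TraceProgress (b.node i).root (b.dir i) (φ i) (φ (i + 1))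

/-- Cyclic proofs, possibly with cuts: regular preproofs each of whose infinite branches has a
progressing trace. -/
def IsCyclicProof (D : Tree) : Prop :=
  D.IsPreproof ∧ D.IsRegular ∧ ∀ b : D.Branch, HasProgressingTrace b

/-- There is a cyclic proof of `Γ` without cuts, that is, in the system `TCL_G`. -/
def CycProvable (Γ : Sequent) : Prop :=
  ∃ D : Tree, IsCyclicProof D ∧ D.CutFree ∧ D.root.concl = Γ

/-- There is a cyclic proof of `Γ` in `TCL_G` extended by the cut rule. -/
def CycProvableWithCut (Γ : Sequent) : Prop :=
  ∃ D : Tree, IsCyclicProof D ∧ D.root.concl = Γ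

/-- Admissibility of cut: whenever the premisses of a cut have cyclic proofs without cuts, so has
its conclusion. -/
def CutAdmissible : Prop :=
  ∀ (Γ : Sequent) (A : Sentence),
    CycProvable (insert A Γ) → CycProvable (insert A.compl Γ) → CycProvable Γ

end TCL

end

noncomputable section

namespace TCL

open FirstOrder

/-! ## Refutation by labels -/

/-! Write G(x) for p(x) ∨ ∃y (TC(a)(x, y) ∧ p(y)). The counterexample says that if 1 is reached from
0 by steps that either follow an edge or start at a point of p, and p(1) holds, then G(0). It is
proved by induction along the steps, with the invariant G at the current point. The invariant moves
with that point, whereas the goal only offers G(0); a cut on `backForm`, "if a(x, y) and G(y) then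
G(x)", makes up the difference. Both premisses of this cut have cut-free cyclic proofs.

No cut-free cyclic proof exists. Terms are labelled by points of disjoint infinite paths with p true
exactly at position k, and the constant 0 labelled (0, 0). All formulas met are false there, except
∃y (TC(a)(0, y) ∧ p(y)), whose witness is only the point (0, k). When a proof instantiates it with a
term beyond position i < k on path 0, the path is cut after i and the rest becomes a new path, so
that the witness is no longer reachable. The cut is harmless unless the sequent contains ā(s, t)
with s at (0, i). By regularity the number of such s is bounded over the whole proof, so for large k
a suitable i always exists. Hence refuted conclusions have refuted premisses, which yields an
infinite branch.

On that branch the number k minus the position of s in a traced formula coTC(A)(s, t) never grows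
and drops at each progress point, so no trace progresses infinitely often.

The argument is carried by `Form.Refuted.detach`, `Step.exists_refuted_premiss` and
`not_cycProvable_of_refuted`; the positive part by `CycProvable.of_loop` and `cycProvable_loop`. -/

/-- The formula `a(x, y)` in the bound variables of a transitive closure operator. -/
def edgeBody (n : ℕ) : Form (n + 2) :=
  .rel (0 : ℕ) (Language.Term.var (Fin.last n).castSucc) (Language.Term.var (Fin.last (n + 1)))

/-- The formula `ā(x, y) ∧ p̄(x)` in the bound variables of a transitive closure operator. -/
def stepBody (n : ℕ) : Form (n + 2) :=
  .and
    (.nrel (0 : ℕ) (Language.Term.var (Fin.last n).castSucc) (Language.Term.var (Fin.last (n + 1))))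
    (.npred (0 : ℕ) (Language.Term.var (Fin.last n).castSucc))

/-- The formula `TC(a)(s, y) ∧ p(y)`, where `y` is the last variable. -/
def reachBody {n : ℕ} (s : Tm (n + 1)) : Form (n + 1) :=
  .and (.tc (edgeBody (n + 1)) s (Language.Term.var (Fin.last n)))
    (.pred (0 : ℕ) (Language.Term.var (Fin.last n)))

/-- A labelling of function symbols, by arity and number. A label `(b, i)` is the position `i` on
the copy number `b` of an infinite path. -/
abbrev Labelling : Type := ℕ → ℕ → ℕ × ℕ

/-- The label of a term is the label of its head symbol. -/
def Tm.label (ρ : Labelling) {n : ℕ} : Tm n → ℕ × ℕ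
  -- Any value other than (0, 0) would do: a term labelled (0, 0) is then never a variable and keeps
  -- its label under instantiation.
  | .var _ => (1, 0)
  | @Language.Term.func _ _ k f _ => ρ k f

/-- The label `y` comes directly after the label `x`. -/
def Edge (x y : ℕ × ℕ) : Prop := y.1 = x.1 ∧ y.2 = x.2 + 1

/-- The label `y` comes after the label `x`. -/
def Reach (x y : ℕ × ℕ) : Prop := y.1 = x.1 ∧ x.2 < y.2

/-- The formula is false in the structure of labels, in which the predicate symbols hold exactly at
the positions `k`, or it is a formula `∃ y (TC(a)(s, y) ∧ p(y))` where `s` is labelled `(0, 0)`. -/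
def Form.Refuted (k : ℕ) (ρ : Labelling) : {n : ℕ} → Form n → Prop
  | _, .pred _ t => (t.label ρ).2 ≠ k
  | _, .npred _ t => (t.label ρ).2 = k
  | _, .rel _ s t => ¬ Edge (s.label ρ) (t.label ρ)
  | _, .nrel _ s t => Edge (s.label ρ) (t.label ρ)
  -- Equalities, inequalities and universal formulas do not arise above the counterexample without
  -- cuts, so the rules introducing them never have a refuted conclusion.
  | _, .eq _ _ => False
  | _, .neq _ _ => False
  | _, .and A B => A.Refuted k ρ ∨ B.Refuted k ρ
  | _, .or A B => A.Refuted k ρ ∧ B.Refuted k ρ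
  | _, .all _ => False
  | _, .ex A => ∃ s, A = reachBody s ∧ s.label ρ = (0, 0)
  | _, .tc A s t => A = edgeBody _ ∧ ¬ Reach (s.label ρ) (t.label ρ)
  -- From s one can follow edges up to position k, and there p permits a step to any target; so the
  -- second argument plays no role.
  | _, .cotc A s _ => A = stepBody _ ∧ (s.label ρ).2 ≤ k

/-- The first arguments of the negated relation symbols in the quantifier-free part. -/
def Form.sources : {n : ℕ} → Form n → Set (Tm n)
  | _, .nrel _ s _ => {s}
  | _, .and A B => A.sources ∪ B.sources
  | _, .or A B => A.sources ∪ B.sources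
  | _, _ => ∅

theorem Form.sources_finite {n : ℕ} (A : Form n) : A.sources.Finite := by
  induction A <;> simp_all [Form.sources]

/-- Moves the positions after `j` of the path number `0` to a new path. -/
def detach (j : ℕ) (x : ℕ × ℕ) : ℕ × ℕ := if x.1 = 0 ∧ x.2 ≤ j then x else (x.1 + 1, x.2)

theorem detach_snd (j : ℕ) (x : ℕ × ℕ) : (detach j x).2 = x.2 := by
  unfold detach; split_ifs <;> rfl

/-- Detaching keeps positions and separates one path without merging any, so it creates no new
edges. -/
theorem edge_detach {j : ℕ} {x y : ℕ × ℕ} (h : Edge (detach j x) (detach j y)) : Edge x y := by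
  unfold Edge detach at *; split_ifs at h <;> grind

theorem reach_detach {j : ℕ} {x y : ℕ × ℕ} (h : Reach (detach j x) (detach j y)) : Reach x y := by
  unfold Reach detach at *; split_ifs at h <;> grind

/-- The edge from (0, j) to (0, j + 1) is the only one that is lost. -/
theorem Edge.detach {j : ℕ} {x y : ℕ × ℕ} (h : Edge x y) (hx : x ≠ (0, j)) :
    Edge (detach j x) (detach j y) := by
  obtain ⟨b, i⟩ := x
  obtain ⟨b', i'⟩ := y
  simp only [Edge, TCL.detach, ne_eq, Prod.mk.injEq] at *
  split_ifs <;> grind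

/-- The labelling after moving labels. -/
def Labelling.detach (ρ : Labelling) (j : ℕ) : Labelling := fun n f => TCL.detach j (ρ n f)

theorem Tm.label_detach (ρ : Labelling) (j : ℕ) (t : Tm 0) :
    t.label (ρ.detach j) = detach j (t.label ρ) := by
  cases t with
  | var i => exact i.elim0
  | func f ts => rfl

theorem Tm.label_detach_eq_zero {ρ : Labelling} {j n : ℕ} {t : Tm n} (h : t.label ρ = (0, 0)) :
    t.label (ρ.detach j) = (0, 0) := by
  cases t with
  | var i => simp [Tm.label] at h
  | func f ts =>
    simp only [Tm.label] at h
    simp [Tm.label, Labelling.detach, h, detach]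

/-- Predicates and coTC formulas depend on positions only, and positive edge and TC formulas stay
false when edges disappear. Only ā(s, t) needs an edge to survive, which the condition on sources
guarantees. The existential formula asks only that (0, 0) be fixed. -/
theorem Form.Refuted.detach {k : ℕ} {ρ : Labelling} {j n : ℕ} (hn : n = 0) {A : Form n}
    (h : A.Refuted k ρ) (hs : ∀ s ∈ A.sources, s.label ρ ≠ (0, j)) :
    A.Refuted k (ρ.detach j) := by
  induction A with
  | pred p t => subst hn; simpa [Refuted, Tm.label_detach, detach_snd] using h
  | npred p t => subst hn; simpa [Refuted, Tm.label_detach, detach_snd] using h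
  | rel a s t =>
    subst hn
    simp only [Refuted, Tm.label_detach] at h ⊢
    exact fun h' => h (edge_detach h')
  | nrel a s t =>
    subst hn
    simp only [Refuted, Tm.label_detach] at h ⊢
    exact Edge.detach h (hs s rfl)
  | eq s t => exact h
  | neq s t => exact h
  | and A B hA hB =>
    exact h.imp (fun h => hA hn h fun s hm => hs s (Or.inl hm))
      fun h => hB hn h fun s hm => hs s (Or.inr hm)
  | or A B hA hB =>
    exact ⟨hA hn h.1 fun s hm => hs s (Or.inl hm), hB hn h.2 fun s hm => hs s (Or.inr hm)⟩
  | all A => exact h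
  | ex A =>
    obtain ⟨s, hs, hl⟩ := h
    exact ⟨s, hs, Tm.label_detach_eq_zero hl⟩
  | tc A s t =>
    subst hn
    simp only [Refuted, Tm.label_detach] at h ⊢
    exact ⟨h.1, fun h' => h.2 (reach_detach h')⟩
  | cotc A s t => subst hn; simpa [Refuted, Tm.label_detach, detach_snd] using h

/-- The labelling in which a constant is given a new label. -/
def Labelling.set (ρ : Labelling) (c : ℕ) (x : ℕ × ℕ) : Labelling :=
  fun n f => if n = 0 ∧ f = c then x else ρ n f

theorem Tm.label_set {ρ : Labelling} {c n : ℕ} {x : ℕ × ℕ} {t : Tm n} (h : ¬ t.HasConst c) :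
    t.label (ρ.set c x) = t.label ρ := by
  cases t with
  | var i => rfl
  | @func l f ts =>
    cases l with
    | zero => simp only [Tm.HasConst] at h; simp [Tm.label, Labelling.set, h]
    | succ l => simp [Tm.label, Labelling.set]

theorem Form.Refuted.set {k : ℕ} {ρ : Labelling} {c n : ℕ} {x : ℕ × ℕ} {A : Form n}
    (h : A.Refuted k ρ) (hc : ¬ A.HasConst c) : A.Refuted k (ρ.set c x) := by
  induction A with
  | ex A =>
    obtain ⟨s, rfl, hl⟩ := h
    refine ⟨s, rfl, ?_⟩
    rw [Tm.label_set, hl]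
    simp only [HasConst, reachBody, not_or] at hc
    exact hc.1.2.1
  | and A B hA hB =>
    simp only [HasConst, not_or] at hc
    exact h.imp (hA · hc.1) (hB · hc.2)
  | or A B hA hB =>
    simp only [HasConst, not_or] at hc
    exact ⟨hA h.1 hc.1, hB h.2 hc.2⟩
  | _ =>
    simp only [HasConst, not_or] at hc
    simp_all [Refuted, Tm.label_set]

/-! ### Pulling labels back along symbol substitutions. -/

/-- The labelling before a substitution of symbols. -/
def Labelling.comp (ρ : Labelling) (σ : SymSubst) : Labelling
  | 0, c => (σ.onConst c).label ρ
  | n + 1, f => ρ (n + 1) (σ.onFun n f)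

theorem Tm.label_relabel (ρ : Labelling) {n : ℕ} (g : Fin 0 → Fin n) (t : Tm 0) :
    Tm.label ρ (t.relabel g : Tm n) = t.label ρ := by
  cases t with
  | var i => exact i.elim0
  | func f ts => rfl

theorem Tm.label_comp (ρ : Labelling) (σ : SymSubst) {n : ℕ} (t : Tm n) :
    t.label (ρ.comp σ) = (σ.onTm t).label ρ := by
  cases t with
  | var i => simp [Tm.label, SymSubst.onTm]
  | @func l f ts =>
    cases l with
    | zero =>
      simp only [SymSubst.onTm, Tm.label_relabel]
      rfl
    | succ l => simp [Tm.label, Labelling.comp, SymSubst.onTm]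

/-- Constants are sent to closed terms, so substitutions create no variables. This is why the fixed
bodies, built from bound variables, can be recognised before a substitution as well as after it. -/
theorem SymSubst.onTm_eq_var {σ : SymSubst} {n : ℕ} {t : Tm n} {i : Fin n}
    (h : σ.onTm t = .var i) : t = .var i := by
  cases t with
  | var i => simpa [SymSubst.onTm] using h
  | @func l f ts =>
    cases l with
    | zero =>
      simp only [SymSubst.onTm] at h
      cases hc : σ.onConst f with
      | var i => exact i.elim0
      | func g us => simp [hc, Language.Term.relabel] at h
    | succ l => simp [SymSubst.onTm] at h

theorem SymSubst.onForm_eq_edgeBody {σ : SymSubst} {n : ℕ} {A : Form (n + 2)}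
    (h : σ.onForm A = edgeBody n) : A = edgeBody n := by
  cases A with
  | rel a s t =>
    simp only [SymSubst.onForm, edgeBody, Form.rel.injEq] at h ⊢
    exact ⟨h.1, onTm_eq_var h.2.1, onTm_eq_var h.2.2⟩
  | _ => simp [SymSubst.onForm, edgeBody] at h

theorem SymSubst.onForm_eq_stepBody {σ : SymSubst} {n : ℕ} {A : Form (n + 2)}
    (h : σ.onForm A = stepBody n) : A = stepBody n := by
  cases A with
  | and A B =>
    simp only [SymSubst.onForm, stepBody, Form.and.injEq] at h ⊢
    obtain ⟨hA, hB⟩ := h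
    constructor
    · cases A with
      | nrel a s t =>
        simp only [SymSubst.onForm, Form.nrel.injEq] at hA ⊢
        exact ⟨hA.1, onTm_eq_var hA.2.1, onTm_eq_var hA.2.2⟩
      | _ => simp [SymSubst.onForm] at hA
    · cases B with
      | npred a s =>
        simp only [SymSubst.onForm, Form.npred.injEq] at hB ⊢
        exact ⟨hB.1, onTm_eq_var hB.2⟩
      | _ => simp [SymSubst.onForm] at hB
  | _ => simp [SymSubst.onForm, stepBody] at h

theorem SymSubst.onForm_eq_reachBody {σ : SymSubst} {n : ℕ} {A : Form (n + 1)} {s : Tm (n + 1)}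
    (h : σ.onForm A = reachBody s) : ∃ s', A = reachBody s' ∧ σ.onTm s' = s := by
  cases A with
  | and A B =>
    simp only [SymSubst.onForm, reachBody, Form.and.injEq] at h ⊢
    obtain ⟨hA, hB⟩ := h
    cases A with
    | tc A s' t =>
      simp only [SymSubst.onForm, Form.tc.injEq] at hA
      refine ⟨s', ⟨?_, ?_⟩, hA.2.1⟩
      · rw [onForm_eq_edgeBody hA.1, onTm_eq_var hA.2.2]
      · cases B with
        | pred a s =>
          simp only [SymSubst.onForm, Form.pred.injEq] at hB ⊢
          exact ⟨hB.1, onTm_eq_var hB.2⟩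
        | _ => simp [SymSubst.onForm] at hB
    | _ => simp [SymSubst.onForm] at hA
  | _ => simp [SymSubst.onForm, reachBody] at h

theorem Form.Refuted.comp {k : ℕ} {ρ : Labelling} {σ : SymSubst} {n : ℕ} {A : Form n}
    (h : (σ.onForm A).Refuted k ρ) : A.Refuted k (ρ.comp σ) := by
  induction A with
  | and A B hA hB => exact h.imp hA hB
  | or A B hA hB => exact ⟨hA h.1, hB h.2⟩
  | ex A =>
    obtain ⟨s, hs, hl⟩ := h
    obtain ⟨s', rfl, hs'⟩ := SymSubst.onForm_eq_reachBody hs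
    exact ⟨s', rfl, by rw [Tm.label_comp, hs', hl]⟩
  | tc A s t =>
    simp only [SymSubst.onForm, Refuted, Tm.label_comp] at h ⊢
    exact ⟨SymSubst.onForm_eq_edgeBody h.1, h.2⟩
  | cotc A s t =>
    simp only [SymSubst.onForm, Refuted, Tm.label_comp] at h ⊢
    exact ⟨SymSubst.onForm_eq_stepBody h.1, h.2⟩
  | all A | eq s t | neq s t => exact h
  | _ => simpa only [SymSubst.onForm, Refuted, Tm.label_comp] using h

theorem edgeBody_inst (s t : Tm 0) : (edgeBody 0).inst ![s, t] = .rel (0 : ℕ) s t := by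
  simp [edgeBody, Form.inst, Language.Term.subst]

theorem stepBody_inst (s t : Tm 0) :
    (stepBody 0).inst ![s, t] = .and (.nrel (0 : ℕ) s t) (.npred (0 : ℕ) s) := by
  simp [stepBody, Form.inst, Language.Term.subst]

theorem edgeBody_inst_lift {n m : ℕ} (τ : Fin n → Tm m) :
    (edgeBody n).inst (Form.lift (Form.lift τ)) = edgeBody m := by
  simp [edgeBody, Form.inst, Form.lift, Language.Term.subst, Tm.weaken, Language.Term.relabel]

theorem reachBody_inst (s : Tm 1) (t : Tm 0) : (reachBody s).inst ![t] =
    .and (.tc (edgeBody 0) (s.subst ![t]) t) (.pred (0 : ℕ) t) := by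
  simp [reachBody, Form.inst, Language.Term.subst, edgeBody_inst_lift]

theorem Tm.label_subst {ρ : Labelling} {n m : ℕ} {s : Tm n} (τ : Fin n → Tm m)
    (h : s.label ρ = (0, 0)) : Tm.label ρ (s.subst τ : Tm m) = (0, 0) := by
  cases s with
  | var i => simp [Tm.label] at h
  | func f ts => exact h

/-! ### Ranks along traces, and the choice of a refuted premiss. -/

/-- The number of positions before `k` that are left to a formula `coTC(A)(s, t)`. -/
def Form.rank (k : ℕ) (ρ : Labelling) : Sentence → ℕ
  | .cotc _ s _ => k - (s.label ρ).2
  | _ => 0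

theorem Form.rank_detach (k : ℕ) (ρ : Labelling) (j : ℕ) (A : Sentence) :
    A.rank k (ρ.detach j) = A.rank k ρ := by
  cases A <;> simp [rank, Tm.label_detach, detach_snd]

theorem Form.rank_set {k : ℕ} {ρ : Labelling} {c : ℕ} {x : ℕ × ℕ} {A : Sentence}
    (h : ¬ A.HasConst c) : A.rank k (ρ.set c x) = A.rank k ρ := by
  cases A with
  | cotc A s t =>
    simp only [HasConst, not_or] at h
    simp [rank, Tm.label_set h.2.1]
  | _ => rfl

theorem Form.rank_comp (k : ℕ) (ρ : Labelling) (σ : SymSubst) (A : Sentence) :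
    A.rank k (ρ.comp σ) = Form.rank k ρ (σ.onForm A) := by
  cases A <;> simp [rank, SymSubst.onForm, Tm.label_comp]

/-- Along a trace through the premiss number `j`, ranks do not increase, and they decrease at
progress. -/
def RankDescends (k : ℕ) (r : Step) (j : Fin r.prems.length) (ρ ρ' : Labelling) : Prop :=
  ∀ φ ψ, φ ∈ r.concl → TraceStep r j φ ψ → Form.rank k ρ' ψ ≤ Form.rank k ρ φ ∧
    (TraceProgress r j φ ψ → Form.rank k ρ' ψ < Form.rank k ρ φ)

theorem rankDescends_of_eq {k : ℕ} {r : Step} {j : Fin r.prems.length} {ρ ρ' : Labelling}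
    (h : ∀ φ ∈ r.concl, Form.rank k ρ' φ = Form.rank k ρ φ) (hs : ¬ r.IsSubst)
    (hc : ∀ Γ A s t c, r = .cotc Γ A s t c → j.val ≠ 1) : RankDescends k r j ρ ρ' := by
  have hp : ∀ φ ψ, ¬ TraceProgress r j φ ψ := by
    rintro φ ψ ⟨Γ, A, s, t, c, hr, hj, -⟩
    exact hc _ _ _ _ _ hr hj
  rintro φ ψ hφ (⟨-, rfl⟩ | h' | ⟨σ, Γ, h', -⟩)
  · exact ⟨(h _ hφ).le, fun h' => absurd h' (hp _ _)⟩
  · exact absurd h' (hp _ _)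
  · exact absurd ⟨σ, Γ, h'⟩ hs

/-- Labels change in three cases only: an existential step cuts path 0 after i, a substitution step
pulls them back, and a right coTC premiss places its eigenvariable one position further. Only the
last changes ranks along a trace, and it lowers the rank of the unfolded formula. -/
theorem Step.exists_refuted_premiss {r : Step} (hside : r.SideCond) (hcut : ¬ r.IsCut) {k i : ℕ}
    (hi : i < k) {ρ : Labelling} (hsrc : ∀ A ∈ r.concl, ∀ s ∈ A.sources, s.label ρ ≠ (0, i))
    (h : ∀ A ∈ r.concl, A.Refuted k ρ) :
    ∃ (j : Fin r.prems.length) (ρ' : Labelling),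
      (∀ A ∈ r.prems.get j, A.Refuted k ρ') ∧ RankDescends k r j ρ ρ' := by
  cases r with
  | idPred Γ p t =>
    simp only [concl, Finset.forall_mem_insert] at h
    exact absurd h.2.1 h.1
  | idRel Γ a s t =>
    simp only [concl, Finset.forall_mem_insert] at h
    exact absurd h.2.1 h.1
  | refl Γ t =>
    simp only [concl, Finset.forall_mem_insert] at h
    exact h.1.elim
  | all Γ A c =>
    simp only [concl, Finset.forall_mem_insert] at h
    exact h.1.elim
  | neqLeft Γ s t A =>
    simp only [concl, Finset.forall_mem_insert] at h
    exact h.1.elim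
  | neqRight Γ s t A =>
    simp only [concl, Finset.forall_mem_insert] at h
    exact h.1.elim
  | cut Γ A => exact absurd ⟨Γ, A, rfl⟩ hcut
  | orLeft Γ A B =>
    simp only [concl, Finset.forall_mem_insert] at h
    refine ⟨⟨0, Nat.one_pos⟩, ρ, ?_, rankDescends_of_eq (fun _ _ => rfl) (by simp [IsSubst])
      (by simp)⟩
    exact Finset.forall_mem_insert .. |>.2 ⟨h.1.1, h.2⟩
  | orRight Γ A B =>
    simp only [concl, Finset.forall_mem_insert] at h
    refine ⟨⟨0, Nat.one_pos⟩, ρ, ?_, rankDescends_of_eq (fun _ _ => rfl) (by simp [IsSubst])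
      (by simp)⟩
    exact Finset.forall_mem_insert .. |>.2 ⟨h.1.2, h.2⟩
  | and Γ A B =>
    simp only [concl, Finset.forall_mem_insert] at h
    rcases h with ⟨hA | hB, hΓ⟩
    · exact ⟨⟨0, Nat.two_pos⟩, ρ, Finset.forall_mem_insert .. |>.2 ⟨hA, hΓ⟩,
        rankDescends_of_eq (fun _ _ => rfl) (by simp [IsSubst]) (by simp)⟩
    · exact ⟨⟨1, Nat.one_lt_two⟩, ρ, Finset.forall_mem_insert .. |>.2 ⟨hB, hΓ⟩,
        rankDescends_of_eq (fun _ _ => rfl) (by simp [IsSubst]) (by simp)⟩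
  | wk Γ Γ' =>
    exact ⟨⟨0, Nat.one_pos⟩, ρ, fun A hA => h A (Finset.mem_union_left _ hA),
      rankDescends_of_eq (fun _ _ => rfl) (by simp [IsSubst]) (by simp)⟩
  | subst σ Γ =>
    refine ⟨⟨0, Nat.one_pos⟩, ρ.comp σ, fun A hA => (h _ (Finset.mem_image_of_mem _ hA)).comp, ?_⟩
    rintro φ ψ hφ (⟨h', -⟩ | ⟨_, _, _, _, _, h', -⟩ | ⟨σ', Γ', h', rfl⟩)
    · exact absurd ⟨σ, Γ, rfl⟩ h'
    · cases h'
    · cases h'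
      refine ⟨(Form.rank_comp k ρ σ ψ).le, ?_⟩
      rintro ⟨_, _, _, _, _, h', -⟩
      cases h'
  | tcBase Γ A s t =>
    simp only [concl, Finset.forall_mem_insert] at h
    obtain ⟨⟨rfl, hst⟩, hΓ⟩ := h
    refine ⟨⟨0, Nat.one_pos⟩, ρ, Finset.forall_mem_insert .. |>.2 ⟨?_, hΓ⟩,
        rankDescends_of_eq (fun _ _ => rfl) (by simp [IsSubst]) (by simp)⟩
    rw [edgeBody_inst]
    exact fun he => hst ⟨he.1, he.2 ▸ Nat.lt_succ_self _⟩
  | tcStep Γ A s t u =>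
    simp only [concl, Finset.forall_mem_insert] at h
    obtain ⟨⟨rfl, hst⟩, hΓ⟩ := h
    by_cases he : Edge (s.label ρ) (u.label ρ)
    · refine ⟨⟨1, Nat.one_lt_two⟩, ρ, Finset.forall_mem_insert .. |>.2 ⟨?_, hΓ⟩,
        rankDescends_of_eq (fun _ _ => rfl) (by simp [IsSubst]) (by simp)⟩
      refine ⟨rfl, fun hut => hst ⟨hut.1.trans he.1, ?_⟩⟩
      have := he.2
      have := hut.2
      omega
    · refine ⟨⟨0, Nat.two_pos⟩, ρ, Finset.forall_mem_insert .. |>.2 ⟨?_, hΓ⟩,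
        rankDescends_of_eq (fun _ _ => rfl) (by simp [IsSubst]) (by simp)⟩
      rw [edgeBody_inst]
      exact he
  | ex Γ A t =>
    have hd : ∀ B ∈ (ex Γ A t).concl, B.Refuted k (ρ.detach i) := fun B hB =>
      (h B hB).detach rfl (hsrc B hB)
    simp only [concl, Finset.forall_mem_insert] at hd
    obtain ⟨⟨s, rfl, hs⟩, hΓ⟩ := hd
    refine ⟨⟨0, Nat.one_pos⟩, ρ.detach i, Finset.forall_mem_insert .. |>.2 ⟨?_, hΓ⟩,
        rankDescends_of_eq (fun _ _ => Form.rank_detach ..) (by simp [IsSubst]) (by simp)⟩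
    rw [reachBody_inst]
    -- Before the cut, the position of t is at most i < k, so p(t) fails; otherwise t has left path
    -- 0 and is unreachable from (0, 0).
    by_cases ht : (t.label ρ).1 = 0 ∧ (t.label ρ).2 ≤ i
    · right
      simp only [Form.Refuted, Tm.label_detach, detach_snd]
      omega
    · left
      refine ⟨rfl, fun hr => ?_⟩
      have := hr.1
      rw [Tm.label_subst _ hs, Tm.label_detach, TCL.detach, if_neg ht] at this
      simp at this
  | cotc Γ A s t c =>
    have hside' := hside
    simp only [SideCond, concl, Finset.forall_mem_insert] at hside'
    have hs : ¬ s.HasConst c := fun hs => hside'.1 (Or.inr (Or.inl hs))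
    have h' := h
    simp only [concl, Finset.forall_mem_insert] at h'
    obtain ⟨⟨rfl, hle⟩, hΓ⟩ := h'
    -- At position k the conjunct p̄(s) refutes the left premiss. Before k the branch goes right,
    -- with the eigenvariable as the successor of s.
    rcases hle.eq_or_lt with he | hlt
    · refine ⟨⟨0, Nat.two_pos⟩, ρ, Finset.forall_mem_insert .. |>.2 ⟨?_, hΓ⟩,
        rankDescends_of_eq (fun _ _ => rfl) (by simp [IsSubst]) (by simp)⟩
      rw [stepBody_inst]
      exact Or.inr he
    · obtain ⟨x, hx⟩ : ∃ x : ℕ × ℕ, x = ((s.label ρ).1, (s.label ρ).2 + 1) := ⟨_, rfl⟩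
      have hc : (Tm.cst c : Tm 0).label (ρ.set c x) = x := by
        simp [Tm.cst, Tm.label, Labelling.set]
      refine ⟨⟨1, Nat.one_lt_two⟩, ρ.set c x, Finset.forall_mem_insert .. |>.2 ⟨?_,
        Finset.forall_mem_insert .. |>.2 ⟨?_, fun B hB => (hΓ B hB).set (hside'.2 B hB)⟩⟩, ?_⟩
      · rw [stepBody_inst]
        left
        simp only [Form.Refuted, hc, Tm.label_set hs]
        rw [hx]
        exact ⟨rfl, rfl⟩
      · simp only [Form.Refuted, hc]
        exact ⟨trivial, by rw [hx]; exact hlt⟩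
      · have hp : ∀ φ ψ, TraceProgress (.cotc Γ (stepBody 0) s t c) ⟨1, Nat.one_lt_two⟩ φ ψ →
            Form.rank k (ρ.set c x) ψ < Form.rank k ρ φ := by
          rintro φ ψ ⟨_, _, _, _, _, hr, -, rfl, rfl⟩
          cases hr
          simp only [Form.rank, hc]
          rw [hx]
          omega
        rintro φ ψ hφ (⟨-, rfl⟩ | hpr | ⟨_, _, hr, -⟩)
        · exact ⟨(Form.rank_set (hside _ hφ)).le, hp _ _⟩
        · exact ⟨(hp _ _ hpr).le, hp _ _⟩
        · cases hr

/-- Pigeonhole: a term has one label, so N terms cannot occupy all N + 1 positions. -/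
theorem exists_position_not_mem {N : ℕ} {X : Set (Tm 0)} (hX : X.Finite) (hN : X.ncard ≤ N)
    (ρ : Labelling) : ∃ i < N + 1, ∀ s ∈ X, s.label ρ ≠ (0, i) := by
  by_contra! hcon
  choose! f hf hl using hcon
  have hinj : Set.InjOn f (Finset.range (N + 1)) := by
    intro i hi j hj hij
    have h1 := hl i (by simpa using hi)
    have h2 := hl j (by simpa using hj)
    rw [hij, h2] at h1
    exact (Prod.mk.inj h1).2.symm
  have := Set.ncard_le_ncard (s := f '' Finset.range (N + 1)) (t := X)
    (by rintro _ ⟨i, hi, rfl⟩; exact hf i (by simpa using hi)) hX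
  rw [hinj.ncard_image, Set.ncard_coe_finset, Finset.card_range] at this
  omega

/-- The first arguments of the negated relation symbols in a sequent. -/
def Sequent.sources (Γ : Sequent) : Set (Tm 0) := ⋃ A ∈ Γ, A.sources

theorem Sequent.sources_finite (Γ : Sequent) : (Sequent.sources Γ).Finite :=
  Γ.finite_toSet.biUnion fun A _ => A.sources_finite

/-- This is where regularity enters: k has to be fixed before the branch is built, so one bound must
serve all sequents. -/
theorem Tree.IsRegular.exists_bound {D : Tree} (h : D.IsRegular) :
    ∃ N, ∀ S, D.IsSubtree S → (Sequent.sources S.root.concl).ncard ≤ N := by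
  obtain ⟨N, hN⟩ := (h.image fun S => (Sequent.sources S.root.concl).ncard).bddAbove
  exact ⟨N, fun S hS => hN ⟨S, hS, rfl⟩⟩

/-- A sequent that is refuted by labels with arbitrarily high values of `k` has no cyclic proof
without cuts. -/
theorem not_cycProvable_of_refuted {Γ : Sequent}
    (h : ∀ k, 0 < k → ∃ ρ, ∀ A ∈ Γ, A.Refuted k ρ) : ¬ CycProvable Γ := by
  rintro ⟨D, ⟨hpre, hreg, htr⟩, hcut, hD⟩
  obtain ⟨N, hN⟩ := hreg.exists_bound
  obtain ⟨ρ₀, hρ₀⟩ := h (N + 1) N.succ_pos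
  let State := {x : Tree × Labelling // D.IsSubtree x.1 ∧ ∀ A ∈ x.1.root.concl,
    A.Refuted (N + 1) x.2}
  have hnext : ∀ x : State, ∃ (j : Fin x.1.1.root.prems.length) (y : State),
      y.1.1 = x.1.1.child j ∧ RankDescends (N + 1) x.1.1.root j x.1.2 y.1.2 := by
    rintro ⟨⟨S, ρ⟩, hS, hρ⟩
    obtain ⟨i, hi, hsrc⟩ := exists_position_not_mem (Sequent.sources_finite _) (hN S hS) ρ
    obtain ⟨j, ρ', hρ', hdesc⟩ := Step.exists_refuted_premiss (hpre S hS).1 (hcut S hS) hi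
      (fun A hA s hs => hsrc s (Set.mem_biUnion hA hs)) hρ
    exact ⟨j, ⟨⟨S.child j, ρ'⟩, hS.child _ j, by rw [(hpre S hS).2 j]; exact hρ'⟩, rfl, hdesc⟩
  choose dir next hchild hdesc using hnext
  let st : ℕ → State := fun n => Nat.rec ⟨⟨D, ρ₀⟩, .self, by rw [hD]; exact hρ₀⟩
    (fun _ x => next x) n
  let b : D.Branch :=
    { node := fun i => (st i).1.1
      dir := fun i => dir (st i)
      node_zero := rfl
      node_succ := fun i => hchild (st i) }
  obtain ⟨m, φ, hφ, hprog⟩ := htr b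
  have hd : ∀ i, m ≤ i → _ := fun i hi =>
    hdesc (st i) (φ i) (φ (i + 1)) (hφ i hi).2.1 (hφ i hi).2.2
  have hanti : ∀ n, m ≤ n → ∀ l, Form.rank (N + 1) (st (n + l)).1.2 (φ (n + l)) ≤
      Form.rank (N + 1) (st n).1.2 (φ n) := by
    intro n hn l
    induction l with
    | zero => exact le_rfl
    | succ l ih => exact (hd (n + l) (by omega)).1.trans ih
  -- Infinite descent: after any index some progress makes the rank strictly smaller.
  have hfall : ∀ v n, m ≤ n → Form.rank (N + 1) (st n).1.2 (φ n) ≠ v := by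
    intro v
    induction v using Nat.strong_induction_on with
    | _ v ih =>
      rintro n hn rfl
      obtain ⟨i, hi, -, hp⟩ := hprog n
      obtain ⟨l, rfl⟩ := Nat.exists_eq_add_of_le hi
      exact ih _ (((hd _ (by omega)).2 hp).trans_le (hanti n hn l)) (n + l + 1) (by omega) rfl
  exact hfall _ m le_rfl rfl

/-! ## Cyclic proofs from finite graphs -/

namespace Tree

section Graph

variable {ι : Type} (r : ι → Step) (next : ∀ i, Fin (r i).prems.length → ι ⊕ Tree)

/-- One step of the unravelling of a graph of rule instances whose edges lead to vertices or to
given trees. -/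
def graphStep : ι ⊕ Tree → stepShape.Obj (ι ⊕ Tree)
  | .inl i => ⟨r i, next i⟩
  | .inr T => ⟨T.root, fun j => .inr (T.child j)⟩

/-- The unravelling of a graph of rule instances whose edges lead to vertices or to given trees. -/
def ofGraph (x : ι ⊕ Tree) : Tree := PFunctor.M.corec (graphStep r next) x

theorem child_ofGraph (i : ι) (j : Fin (r i).prems.length) :
    (ofGraph r next (.inl i)).child j = ofGraph r next (next i j) := rfl

theorem ofGraph_inr (T : Tree) : ofGraph r next (.inr T) = T := by
  refine PFunctor.M.bisim (fun x y => x = ofGraph r next (.inr y)) ?_ _ _ rfl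
  rintro _ T rfl
  exact ⟨Tree.root T, fun j => ofGraph r next (.inr (Tree.child T j)), Tree.child T, rfl, rfl, fun _ => rfl⟩

variable {r next}

theorem IsSubtree.ofGraph_cases {i : ι} {S : Tree}
    (h : (ofGraph r next (.inl i)).IsSubtree S) :
    (∃ i', S = ofGraph r next (.inl i')) ∨ ∃ i' j T, next i' j = .inr T ∧ T.IsSubtree S := by
  induction h with
  | self => exact .inl ⟨i, rfl⟩
  | child S j _ ih =>
    rcases ih with ⟨i', rfl⟩ | ⟨i', j', T, hT, hS⟩
    · rw [show (ofGraph r next (.inl i')).child j = _ from child_ofGraph r next i' j]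
      cases hn : next i' j with
      | inl i'' => exact .inl ⟨i'', rfl⟩
      | inr T => exact .inr ⟨i', j, T, hn, by rw [ofGraph_inr]; exact .self⟩
    · exact .inr ⟨i', j', T, hT, hS.child _ j⟩

theorem IsRegular.ofGraph [Finite ι]
    (h : ∀ i j T, next i j = .inr T → T.IsRegular) (i : ι) :
    (ofGraph r next (.inl i)).IsRegular := by
  refine ((Set.finite_range fun i => Tree.ofGraph r next (.inl i)).union
    (Set.finite_iUnion fun i => Set.finite_iUnion fun j =>
      (?_ : {S | ∃ T, next i j = .inr T ∧ T.IsSubtree S}.Finite))).subset fun S hS => ?_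
  · cases hn : next i j with
    | inl i' => simp
    | inr T => simpa [IsRegular] using h i j T hn
  · rcases hS.ofGraph_cases with ⟨i', rfl⟩ | ⟨i', j, T, hT, hS⟩
    · exact .inl ⟨i', rfl⟩
    · exact .inr (Set.mem_iUnion.2 ⟨i', Set.mem_iUnion.2 ⟨j, T, hT, hS⟩⟩)

theorem CutFree.ofGraph (hr : ∀ i, ¬ (r i).IsCut)
    (h : ∀ i j T, next i j = .inr T → T.CutFree) (i : ι) :
    (ofGraph r next (.inl i)).CutFree := by
  intro S hS
  rcases hS.ofGraph_cases with ⟨i', rfl⟩ | ⟨i', j, T, hT, hS⟩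
  · exact hr i'
  · exact h i' j T hT S hS

theorem IsPreproof.ofGraph (hr : ∀ i, (r i).SideCond)
    (hl : ∀ i j i', next i j = .inl i' → (r i').concl = (r i).prems.get j)
    (h : ∀ i j T, next i j = .inr T → T.IsPreproof ∧ T.root.concl = (r i).prems.get j) (i : ι) :
    (ofGraph r next (.inl i)).IsPreproof := by
  intro S hS
  rcases hS.ofGraph_cases with ⟨i', rfl⟩ | ⟨i', j, T, hT, hS⟩
  · refine ⟨hr i', fun j => ?_⟩
    rw [show (Tree.ofGraph r next (.inl i')).child j = _ from child_ofGraph r next i' j]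
    cases hn : next i' j with
    | inl i'' => exact hl _ _ _ hn
    | inr T => rw [ofGraph_inr]; exact (h _ _ _ hn).2
  · exact (h i' j T hT).1 S hS

/-- A branch without its first nodes. -/
def Branch.drop {D : Tree} (b : D.Branch) (n : ℕ) : (b.node n).Branch where
  node i := b.node (n + i)
  dir i := b.dir (n + i)
  node_zero := rfl
  node_succ i := b.node_succ (n + i)

theorem hasProgressingTrace_of_drop {D : Tree} {b : D.Branch} {n : ℕ}
    (h : HasProgressingTrace (b.drop n)) : HasProgressingTrace b := by
  obtain ⟨k, φ, ht, hp⟩ := h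
  refine ⟨n + k, fun i => φ (i - n), fun i hi => ?_, fun m => ?_⟩
  · obtain ⟨l, rfl⟩ := Nat.exists_eq_add_of_le (show n ≤ i by omega)
    have := ht l (by omega)
    simp only [Nat.add_sub_cancel_left, show n + l + 1 - n = l + 1 by omega]
    exact this
  · obtain ⟨i, hi, hk, hpr⟩ := hp m
    refine ⟨n + i, by omega, by omega, ?_⟩
    simp only [Nat.add_sub_cancel_left, show n + i + 1 - n = i + 1 by omega]
    exact hpr

/-- An infinite branch of the unravelling of a graph reaches one of the given trees or follows a
path in the graph. -/
theorem Branch.ofGraph_cases {i : ι} (b : (ofGraph r next (.inl i)).Branch) :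
    (∃ n i' j T, next i' j = .inr T ∧ b.node n = T) ∨
      ∃ v : ℕ → ι, (∀ n, b.node n = ofGraph r next (.inl (v n))) ∧
        ∀ n, ∃ j, HEq (b.dir n) j ∧ next (v n) j = .inl (v (n + 1)) := by
  by_cases hb : ∃ n i' j T, next i' j = .inr T ∧ b.node n = T
  · exact .inl hb
  right
  have hstep : ∀ n i', b.node n = ofGraph r next (.inl i') →
      ∃ i'', b.node (n + 1) = ofGraph r next (.inl i'') ∧
        ∃ j, HEq (b.dir n) j ∧ next i' j = .inl i'' := by
    intro n i' hn
    have hs := b.node_succ n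
    generalize b.dir n = j at hs ⊢
    generalize hS : b.node n = S at *
    subst hn
    rw [show (ofGraph r next (.inl i')).child j = _ from child_ofGraph r next i' j] at hs
    cases hj : next i' j with
    | inl i'' => exact ⟨i'', by rw [hs, hj], j, HEq.rfl, hj⟩
    | inr T => exact absurd ⟨n + 1, i', j, T, hj, by rw [hs, hj, ofGraph_inr]⟩ hb
  choose g hg using hstep
  let st : ∀ n, {i' // b.node n = ofGraph r next (.inl i')} := fun n =>
    Nat.rec ⟨i, b.node_zero⟩ (fun n x => ⟨g n x.1 x.2, (hg n x.1 x.2).1⟩) n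
  exact ⟨fun n => (st n).1, fun n => (st n).2, fun n => (hg n _ (st n).2).2⟩

/-- The unravelling of a finite graph of rule instances is a cyclic proof if the trees it leads to
are, and if every vertex is assigned a formula such that along each edge the formulas form a trace
which progresses, or a natural number decreases. -/
theorem isCyclicProof_ofGraph [Finite ι] (φ : ι → Sentence) (rk : ι → ℕ)
    (hr : ∀ i, (r i).SideCond)
    (hl : ∀ i j i', next i j = .inl i' → (r i').concl = (r i).prems.get j)
    (htr : ∀ i j i', next i j = .inl i' → (IsCotc (φ i) ∧ φ i ∈ (r i).concl ∧
      TraceStep (r i) j (φ i) (φ i')) ∧ (TraceProgress (r i) j (φ i) (φ i') ∨ rk i' < rk i))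
    (h : ∀ i j T, next i j = .inr T → IsCyclicProof T ∧ T.root.concl = (r i).prems.get j)
    (i : ι) : IsCyclicProof (ofGraph r next (.inl i)) := by
  refine ⟨.ofGraph hr hl (fun i j T hT => ⟨(h i j T hT).1.1, (h i j T hT).2⟩) i,
    .ofGraph (fun i j T hT => (h i j T hT).1.2.1) i, fun b => ?_⟩
  rcases b.ofGraph_cases with ⟨n, i', j, T, hT, hn⟩ | ⟨v, hv, hdir⟩
  · refine hasProgressingTrace_of_drop (n := n) ?_
    have := (h i' j T hT).1.2.2
    rw [← hn] at this
    exact this _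
  · have key : ∀ n, (IsCotc (φ (v n)) ∧ φ (v n) ∈ (b.node n).root.concl ∧
        TraceStep (b.node n).root (b.dir n) (φ (v n)) (φ (v (n + 1)))) ∧
        (TraceProgress (b.node n).root (b.dir n) (φ (v n)) (φ (v (n + 1))) ∨
          rk (v (n + 1)) < rk (v n)) := by
      intro n
      obtain ⟨j, hj, hnext⟩ := hdir n
      have := htr _ _ _ hnext
      have hvn := hv n
      generalize b.dir n = j' at hj ⊢
      generalize b.node n = S at *
      subst hvn
      cases hj
      exact this
    refine ⟨0, fun n => φ (v n), fun n _ => (key n).1, fun m => ?_⟩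
    by_contra! hcon
    have hlt : ∀ n, m ≤ n → rk (v (n + 1)) < rk (v n) := fun n hn =>
      (key n).2.resolve_left (hcon n hn n.zero_le)
    have hle : ∀ n, rk (v (m + n)) + n ≤ rk (v m) := by
      intro n
      induction n with
      | zero => simp
      | succ n ih =>
        have := hlt (m + n) (by omega)
        rw [← Nat.add_assoc m n 1]
        omega
    have := hle (rk (v m) + 1)
    omega

end Graph

end Tree

theorem CycProvableWithCut.step (r : Step) (hr : r.SideCond)
    (h : ∀ Δ ∈ r.prems, CycProvableWithCut Δ) : CycProvableWithCut r.concl := by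
  have h' : ∀ j : Fin r.prems.length, CycProvableWithCut (r.prems.get j) := fun j =>
    h _ (List.get_mem _ _)
  choose T hT hconcl using h'
  -- A single vertex whose edges all leave the graph; the formula and the rank assigned to it are
  -- dummies.
  refine ⟨Tree.ofGraph (fun _ : Unit => r) (fun _ j => .inr (T j)) (.inl ()),
    Tree.isCyclicProof_ofGraph (fun _ => .eq (Tm.cst 0) (Tm.cst 0)) (fun _ => 0) (fun _ => hr)
      (by simp) (by simp) ?_ _, rfl⟩
  rintro _ j _ ⟨⟩
  exact ⟨hT j, hconcl j⟩

theorem CycProvable.withCut {Γ : Sequent} (h : CycProvable Γ) : CycProvableWithCut Γ := by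
  obtain ⟨D, hD, -, hΓ⟩ := h
  exact ⟨D, hD, hΓ⟩

theorem CycProvable.step (r : Step) (hr : r.SideCond) (hcut : ¬ r.IsCut)
    (h : ∀ Δ ∈ r.prems, CycProvable Δ) : CycProvable r.concl := by
  have h' : ∀ j : Fin r.prems.length, CycProvable (r.prems.get j) := fun j =>
    h _ (List.get_mem _ _)
  choose T hT hcf hconcl using h'
  refine ⟨Tree.ofGraph (fun _ : Unit => r) (fun _ j => .inr (T j)) (.inl ()),
    Tree.isCyclicProof_ofGraph (fun _ => .eq (Tm.cst 0) (Tm.cst 0)) (fun _ => 0) (fun _ => hr)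
      (by simp) (by simp) ?_ _, .ofGraph (fun _ => hcut) ?_ _, rfl⟩
  · rintro _ j _ ⟨⟩
    exact ⟨hT j, hconcl j⟩
  · rintro _ j _ ⟨⟩
    exact hcf j

/-- A loop of rule instances, the first of which unfolds the traced formula, gives a cyclic proof if
the premisses that are not on the loop have cyclic proofs. -/
theorem CycProvable.of_loop {m : ℕ} (r : Fin (m + 1) → Step) (d : Fin (m + 1) → ℕ)
    (φ : Fin (m + 1) → Sentence) (hr : ∀ i, (r i).SideCond) (hcut : ∀ i, ¬ (r i).IsCut)
    (hd : ∀ i, (r i).prems[d i]? = some (r (i + 1)).concl)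
    (hother : ∀ i, ∀ Δ ∈ (r i).prems.eraseIdx (d i), CycProvable Δ)
    (hφ : ∀ i, IsCotc (φ i) ∧ φ i ∈ (r i).concl)
    (htr : ∀ i j, j.val = d i → TraceStep (r i) j (φ i) (φ (i + 1)))
    (hp : ∀ j, j.val = d 0 → TraceProgress (r 0) j (φ 0) (φ 1)) : CycProvable (r 0).concl := by
  have hT : ∀ i (j : Fin (r i).prems.length), ∃ T : Tree, j.val ≠ d i →
      IsCyclicProof T ∧ T.CutFree ∧ T.root.concl = (r i).prems.get j := by
    intro i j
    by_cases hj : j.val = d i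
    · exact ⟨Tree.ofGraph r (fun _ _ => .inl 0) (.inl 0), fun h => absurd hj h⟩
    · obtain ⟨T, hT⟩ := hother i _ (List.mem_eraseIdx_iff_getElem?.2
        ⟨j, hj, List.getElem?_eq_getElem j.2⟩)
      exact ⟨T, fun _ => hT⟩
  choose T hT using hT
  let next : ∀ i, Fin (r i).prems.length → Fin (m + 1) ⊕ Tree := fun i j =>
    if j.val = d i then .inl (i + 1) else .inr (T i j)
  have hinl : ∀ {i j i'}, next i j = .inl i' → j.val = d i ∧ i' = i + 1 := by
    intro i j i' h
    simp only [next] at h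
    split_ifs at h with hj
    exact ⟨hj, (Sum.inl.inj h).symm⟩
  have hinr : ∀ {i j S}, next i j = .inr S → j.val ≠ d i ∧ S = T i j := by
    intro i j S h
    simp only [next] at h
    split_ifs at h with hj
    exact ⟨hj, (Sum.inr.inj h).symm⟩
  refine ⟨Tree.ofGraph r next (.inl 0), Tree.isCyclicProof_ofGraph φ
    -- The distance to the return to vertex 0. It falls on every edge except the one leaving 0,
    -- where the trace progresses.
    (fun i => if i = 0 then 0 else m + 1 - i.val) hr ?_ ?_ ?_ _, .ofGraph hcut ?_ _, rfl⟩
  · intro i j i' h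
    obtain ⟨hj, rfl⟩ := hinl h
    have := hd i
    rw [← hj, List.getElem?_eq_getElem j.2] at this
    exact (Option.some.inj this).symm
  · intro i j i' h
    obtain ⟨hj, rfl⟩ := hinl h
    refine ⟨⟨(hφ i).1, (hφ i).2, htr i j hj⟩, ?_⟩
    by_cases hi : i = 0
    · subst hi
      left
      rw [zero_add]
      exact hp j hj
    · right
      have := i.2
      simp only [hi, if_false]
      split_ifs with h0
      · omega
      · have hne : i ≠ Fin.last m := fun hl => h0 (by rw [hl, Fin.last_add_one])
        rw [Fin.val_add_one_of_lt (Fin.lt_last_iff_ne_last.2 hne)]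
        omega
  · intro i j S h
    obtain ⟨hj, rfl⟩ := hinr h
    exact ⟨(hT i j hj).1, (hT i j hj).2.2⟩
  · intro i j S h
    obtain ⟨hj, rfl⟩ := hinr h
    exact (hT i j hj).2.1

/-! ## Derived rules -/

namespace CycProvable

theorem mono {Γ Δ : Sequent} (h : CycProvable Γ) (hs : Γ ⊆ Δ) : CycProvable Δ := by
  have := step (.wk Γ Δ) trivial (by simp [Step.IsCut]) (by simpa [Step.prems] using h)
  rwa [Step.concl, Finset.union_eq_right.2 hs] at this

theorem of_pred_mem {Γ : Sequent} {p : ℕ} {t : Tm 0} (h : Form.pred p t ∈ Γ)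
    (h' : Form.npred p t ∈ Γ) : CycProvable Γ :=
  (step (.idPred ∅ p t) trivial (by simp [Step.IsCut]) (by simp [Step.prems])).mono
    (by simp [Step.concl, Finset.insert_subset_iff, h, h'])

theorem of_rel_mem {Γ : Sequent} {a : ℕ} {s t : Tm 0} (h : Form.rel a s t ∈ Γ)
    (h' : Form.nrel a s t ∈ Γ) : CycProvable Γ :=
  (step (.idRel ∅ a s t) trivial (by simp [Step.IsCut]) (by simp [Step.prems])).mono
    (by simp [Step.concl, Finset.insert_subset_iff, h, h'])

theorem of_or_mem {Γ : Sequent} {A B : Sentence} (h : Form.or A B ∈ Γ)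
    (hp : CycProvable (insert A (insert B Γ))) : CycProvable Γ := by
  have h1 := step (.orRight (insert A Γ) A B) trivial (by simp [Step.IsCut])
    (by simpa [Step.prems, Finset.insert_comm B A] using hp)
  have h2 := step (.orLeft Γ A B) trivial (by simp [Step.IsCut])
    (by simpa [Step.prems, Step.concl, h] using h1)
  simpa [Step.concl, h] using h2

theorem of_and_mem {Γ : Sequent} {A B : Sentence} (h : Form.and A B ∈ Γ)
    (hA : CycProvable (insert A Γ)) (hB : CycProvable (insert B Γ)) : CycProvable Γ := by
  have := step (.and Γ A B) trivial (by simp [Step.IsCut]) (by simp [Step.prems, hA, hB])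
  simpa [Step.concl, h] using this

theorem of_ex_mem {Γ : Sequent} {A : Form 1} (h : Form.ex A ∈ Γ) (t : Tm 0)
    (hp : CycProvable (insert (A.inst ![t]) Γ)) : CycProvable Γ := by
  have := step (.ex Γ A t) trivial (by simp [Step.IsCut]) (by simpa [Step.prems] using hp)
  simpa [Step.concl, h] using this

theorem of_all_mem {Γ : Sequent} {A : Form 1} (h : Form.all A ∈ Γ) (c : ℕ)
    (hc : ∀ B ∈ Γ, ¬ B.HasConst c)
    (hp : CycProvable (insert (A.inst ![Tm.cst c]) Γ)) : CycProvable Γ := by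
  have := step (.all Γ A c) (by simpa [Step.SideCond, Step.concl, h] using hc)
    (by simp [Step.IsCut]) (by simpa [Step.prems] using hp)
  simpa [Step.concl, h] using this

theorem of_tc_mem {Γ : Sequent} {A : Form 2} {s t : Tm 0} (h : Form.tc A s t ∈ Γ)
    (hp : CycProvable (insert (A.inst ![s, t]) Γ)) : CycProvable Γ := by
  have := step (.tcBase Γ A s t) trivial (by simp [Step.IsCut]) (by simpa [Step.prems] using hp)
  simpa [Step.concl, h] using this

theorem of_tc_mem_step {Γ : Sequent} {A : Form 2} {s t : Tm 0} (h : Form.tc A s t ∈ Γ) (u : Tm 0)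
    (h1 : CycProvable (insert (A.inst ![s, u]) Γ)) (h2 : CycProvable (insert (.tc A u t) Γ)) :
    CycProvable Γ := by
  have := step (.tcStep Γ A s t u) trivial (by simp [Step.IsCut]) (by simp [Step.prems, h1, h2])
  simpa [Step.concl, h] using this

end CycProvable

/-! ## Computations with terms and formulas -/

@[simp] theorem Tm.hasConst_cst {n c d : ℕ} : (Tm.cst d : Tm n).HasConst c ↔ d = c := by
  simp [Tm.cst, Tm.HasConst]

@[simp] theorem Tm.hasConst_var {n c : ℕ} {i : Fin n} :
    ¬ Tm.HasConst c (Language.Term.var i : Tm n) := by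
  simp [Tm.HasConst]

@[simp] theorem Tm.weaken_cst {n c : ℕ} : (Tm.cst c : Tm n).weaken = Tm.cst c := by
  simp only [Tm.cst, Tm.weaken, Language.Term.relabel]
  congr 1
  exact Subsingleton.elim _ _

@[simp] theorem Tm.subst_cst {n m c : ℕ} (τ : Fin n → Tm m) :
    Language.Term.subst (Tm.cst c : Tm n) τ = Tm.cst c := by
  simp only [Tm.cst, Language.Term.subst]
  congr 1
  exact Subsingleton.elim _ _

theorem Tm.weaken_subst_lift {n m : ℕ} (τ : Fin n → Tm m) (t : Tm n) :
    Language.Term.subst t.weaken (Form.lift τ) = Tm.weaken (Language.Term.subst t τ) := by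
  induction t with
  | var i => simp [Tm.weaken, Language.Term.relabel, Language.Term.subst, Form.lift]
  | func f ts ih =>
    simp only [Tm.weaken, Language.Term.relabel, Language.Term.subst] at ih ⊢
    congr 1
    exact funext ih

theorem Form.compl_inst {n m : ℕ} (A : Form n) (τ : Fin n → Tm m) :
    A.compl.inst τ = (A.inst τ).compl := by
  induction A generalizing m <;> simp_all [Form.compl, Form.inst]

theorem Form.lift_last {n m : ℕ} (τ : Fin n → Tm m) :
    Form.lift τ (Fin.last n) = Language.Term.var (Fin.last m) := by
  simp [lift]

/-- The formula `p(t) ∨ ∃ y (TC(a)(t, y) ∧ p(y))`. -/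
def goalForm {n : ℕ} (t : Tm n) : Form n := .or (.pred (0 : ℕ) t) (.ex (reachBody t.weaken))

theorem goalForm_inst {n m : ℕ} (t : Tm n) (τ : Fin n → Tm m) :
    (goalForm t).inst τ = goalForm (Language.Term.subst t τ) := by
  simp [goalForm, reachBody, Form.inst, Tm.weaken_subst_lift, edgeBody_inst_lift,
    Language.Term.subst, Form.lift_last]

/-- The formula saying that for `a(x, y)`, the goal for `y` implies the goal for `x`, in the
variables `x` and `y`. -/
def backBody : Form 2 :=
  .or (.nrel (0 : ℕ) (Language.Term.var 0) (Language.Term.var 1))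
    (.or (goalForm (Language.Term.var 1)).compl (goalForm (Language.Term.var 0)))

theorem backBody_inst (a b : ℕ) :
    (backBody.inst (Form.lift ![(Tm.cst a : Tm 0)])).inst ![(Tm.cst b : Tm 0)] =
      .or (.nrel (0 : ℕ) (Tm.cst a) (Tm.cst b))
        (.or (goalForm (Tm.cst b)).compl (goalForm (Tm.cst a))) := by
  have h0 : Form.lift ![(Tm.cst a : Tm 0)] 0 = Tm.cst a := Tm.weaken_cst
  have h1 : Form.lift ![(Tm.cst a : Tm 0)] 1 = Language.Term.var 1 := rfl
  simp [backBody, Form.inst, Form.compl_inst, goalForm_inst, Language.Term.subst, h0, h1]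

/-- The substitution that renames the constant `c` to `e`. -/
def SymSubst.rename (c e : ℕ) : SymSubst where
  onConst x := Tm.cst (if x = c then e else x)
  onFun _ f := f

@[simp] theorem SymSubst.rename_cst {c e x n : ℕ} :
    (SymSubst.rename c e).onTm (Tm.cst x : Tm n) = Tm.cst (if x = c then e else x) := by
  simp only [Tm.cst, SymSubst.onTm, SymSubst.rename, Language.Term.relabel]
  congr 1
  exact Subsingleton.elim _ _

/-! ### The identity sequent for TC(a). -/

theorem edgeBody_compl_inst (s t : Tm 0) :
    (edgeBody 0).compl.inst ![s, t] = .nrel (0 : ℕ) s t := by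
  rw [Form.compl_inst, edgeBody_inst]; rfl

/-- Unfold coTC with a fresh e, answer with a TC step through e, then discard the edge and rename c
to e to close the cycle. The renaming must leave the endpoint d alone, hence c ≠ d. -/
theorem cycProvable_tc_cotc {c d : ℕ} (hcd : c ≠ d) : CycProvable
    {Form.cotc (edgeBody 0).compl (Tm.cst c) (Tm.cst d),
      .tc (edgeBody 0) (Tm.cst c) (Tm.cst d)} := by
  obtain ⟨e, he⟩ := Finset.exists_notMem ({c, d} : Finset ℕ)
  simp only [Finset.mem_insert, Finset.mem_singleton, not_or] at he
  obtain ⟨hec, hed⟩ := he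
  let K (x : ℕ) : Sentence := .cotc (edgeBody 0).compl (Tm.cst x) (Tm.cst d)
  let T (x : ℕ) : Sentence := .tc (edgeBody 0) (Tm.cst x) (Tm.cst d)
  let N : Sentence := .nrel (0 : ℕ) (Tm.cst c) (Tm.cst e)
  have hK : (SymSubst.rename c e).onForm (K c) = K e := by
    simp [K, SymSubst.onForm, hcd.symm, edgeBody, Form.compl, SymSubst.onTm]
  have hT : (SymSubst.rename c e).onForm (T c) = T e := by
    simp [T, SymSubst.onForm, hcd.symm, edgeBody, SymSubst.onTm]
  refine CycProvable.of_loop (m := 3)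
    ![.cotc {T c} (edgeBody 0).compl (Tm.cst c) (Tm.cst d) e,
      .tcStep {N, K e} (edgeBody 0) (Tm.cst c) (Tm.cst d) (Tm.cst e),
      .wk {K e, T e} {N},
      .subst (SymSubst.rename c e) {K c, T c}] ![1, 1, 0, 0] ![K c, K e, K e, K e]
    ?_ ?_ ?_ ?_ ?_ ?_ ?_
  · intro i
    fin_cases i
    · simp [Step.SideCond, Step.concl, Form.HasConst, edgeBody, Form.compl, T, Ne.symm hec,
        Ne.symm hed]
    all_goals trivial
  · intro i
    fin_cases i <;> simp [Step.IsCut]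
  · intro i
    fin_cases i
    · simp [Step.prems, Step.concl, edgeBody_compl_inst]
      change ({N, K e, T c} : Sequent) = {T c, N, K e}
      ext
      simp only [Finset.mem_insert, Finset.mem_singleton]
      tauto
    · simp [Step.prems, Step.concl]
      change ({T e, N, K e} : Sequent) = {K e, T e, N}
      ext
      simp only [Finset.mem_insert, Finset.mem_singleton]
      tauto
    · simp [Step.prems, Step.concl, hK, hT]
    · rfl
  · intro i
    fin_cases i
    · simp [Step.prems, edgeBody_compl_inst]
      refine .of_tc_mem (A := edgeBody 0) (s := Tm.cst c) (t := Tm.cst d) (by simp [T]) ?_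
      rw [edgeBody_inst]
      exact .of_rel_mem (a := 0) (s := Tm.cst c) (t := Tm.cst d) (by simp) (by simp)
    · simp [Step.prems, edgeBody_inst]
      exact .of_rel_mem (a := 0) (s := Tm.cst c) (t := Tm.cst e) (by simp) (by simp [N])
    · simp [Step.prems]
    · simp [Step.prems]
  · intro i
    fin_cases i <;> exact ⟨⟨_, _, _, rfl⟩, by simp [Step.concl, hK, K]⟩
  · intro i j hj
    fin_cases i
    · exact .inr (.inl ⟨_, _, _, _, _, rfl, hj, rfl, rfl⟩)
    · exact .inl ⟨by simp [Step.IsSubst], rfl⟩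
    · exact .inl ⟨by simp [Step.IsSubst], rfl⟩
    · exact .inr (.inr ⟨_, _, rfl, hK⟩)
  · intro j hj
    exact ⟨_, _, _, _, _, rfl, hj, rfl, rfl⟩

/-! ### Existence of fresh constants. -/

theorem Tm.finite_hasConst {n : ℕ} (t : Tm n) : {c | t.HasConst c}.Finite := by
  induction t with
  | var i => simp [HasConst]
  | @func l f ts ih =>
    cases l with
    | zero => simp [HasConst]
    | succ l =>
      simp only [HasConst, Set.ofPred_exists]
      exact Set.finite_iUnion ih

theorem Form.finite_hasConst {n : ℕ} (A : Form n) : {c | A.HasConst c}.Finite := by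
  induction A <;> simp_all [HasConst, Set.ofPred_or, Tm.finite_hasConst]

theorem Sequent.exists_fresh (Γ : Sequent) : ∃ c, ∀ B ∈ Γ, ¬ B.HasConst c := by
  obtain ⟨c, hc⟩ := (Γ.finite_toSet.biUnion fun B _ => B.finite_hasConst).exists_notMem
  exact ⟨c, fun B hB h => hc (Set.mem_biUnion hB h)⟩

/-! ## Derivations of the premisses of the cut -/

theorem CycProvable.of_goalForm_mem {Γ : Sequent} {a b : ℕ} (h : goalForm (Tm.cst a) ∈ Γ)
    (hb : Form.npred (0 : ℕ) (Tm.cst b) ∈ Γ)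
    (hp : CycProvable (insert (.tc (edgeBody 0) (Tm.cst a) (Tm.cst b)) Γ)) : CycProvable Γ := by
  refine .of_or_mem h (.of_ex_mem (A := reachBody (Tm.cst a)) (by simp) (Tm.cst b) ?_)
  rw [reachBody_inst, Tm.subst_cst]
  refine .of_and_mem (Finset.mem_insert_self ..) (hp.mono ?_) ?_
  · intro
    simp only [Finset.mem_insert]
    tauto
  · exact .of_pred_mem (p := 0) (t := Tm.cst b) (by simp) (by simp [hb])

theorem CycProvable.of_goalForm_mem_of_pred {Γ : Sequent} {a : ℕ} (h : goalForm (Tm.cst a) ∈ Γ)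
    (ha : Form.npred (0 : ℕ) (Tm.cst a) ∈ Γ) : CycProvable Γ :=
  .of_or_mem h (.of_pred_mem (p := 0) (t := Tm.cst a) (by simp) (by simp [ha]))

theorem CycProvable.of_goalForm_mem_of_rel {Γ : Sequent} {a b : ℕ} (h : goalForm (Tm.cst a) ∈ Γ)
    (hab : Form.nrel (0 : ℕ) (Tm.cst a) (Tm.cst b) ∈ Γ)
    (hb : Form.npred (0 : ℕ) (Tm.cst b) ∈ Γ) : CycProvable Γ := by
  refine .of_goalForm_mem h hb (.of_tc_mem (Finset.mem_insert_self ..) ?_)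
  rw [edgeBody_inst]
  exact .of_rel_mem (a := 0) (s := Tm.cst a) (t := Tm.cst b) (by simp) (by simp [hab])

theorem CycProvable.of_tc_cotc_mem {Γ : Sequent} {a b : ℕ} (hab : a ≠ b)
    (h : Form.tc (edgeBody 0) (Tm.cst a) (Tm.cst b) ∈ Γ)
    (h' : Form.cotc (edgeBody 0).compl (Tm.cst a) (Tm.cst b) ∈ Γ) : CycProvable Γ :=
  (cycProvable_tc_cotc hab).mono (by simp [Finset.insert_subset_iff, h, h'])

/-- Case analysis on an assumed G(b): either p(b), or b reaches a fresh e with p(e). Quantifying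
over all larger Δ spares tracking the exact sequent. -/
theorem CycProvable.of_goalForm_compl_mem {Γ : Sequent} {b : ℕ}
    (h : (goalForm (Tm.cst b)).compl ∈ Γ)
    (h1 : CycProvable (insert (.npred (0 : ℕ) (Tm.cst b)) Γ))
    (h2 : ∀ e, b ≠ e → ∀ Δ, Γ ⊆ Δ → Form.npred (0 : ℕ) (Tm.cst e) ∈ Δ →
      Form.cotc (edgeBody 0).compl (Tm.cst b) (Tm.cst e) ∈ Δ → CycProvable Δ) :
    CycProvable Γ := by
  refine .of_and_mem h h1 ?_
  obtain ⟨e, he⟩ := Sequent.exists_fresh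
    (insert (.all (reachBody (Tm.cst b : Tm 0).weaken).compl) Γ)
  have hbe : b ≠ e := by
    have := he _ (Finset.mem_insert_self ..)
    simp only [Tm.weaken_cst, reachBody, Form.compl, Form.HasConst, Tm.hasConst_cst, not_or] at this
    exact this.1.2.1
  refine .of_all_mem (Finset.mem_insert_self ..) e he ?_
  rw [Form.compl_inst, reachBody_inst, Tm.weaken_cst, Tm.subst_cst]
  refine .of_or_mem (Finset.mem_insert_self ..) (h2 e hbe _ ?_ ?_ ?_)
  · intro
    simp only [Finset.mem_insert]
    tauto
  · simp [Form.compl]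
  · simp [Form.compl]

theorem CycProvable.of_goalForm_mem_of_compl_mem {Γ : Sequent} {a : ℕ}
    (h : goalForm (Tm.cst a) ∈ Γ) (h' : (goalForm (Tm.cst a)).compl ∈ Γ) : CycProvable Γ :=
  .of_goalForm_compl_mem h' (.of_goalForm_mem_of_pred (Finset.mem_insert_of_mem h) (by simp))
    fun _ he _ hΔ hp hc => .of_goalForm_mem (hΔ h) hp
      (.of_tc_cotc_mem he (by simp) (Finset.mem_insert_of_mem hc))

/-- The cut formula: the goal is inherited backwards along `a`. -/
def backForm : Sentence := .all (.all backBody)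

/-- Given an edge from a to b, the witness for G(a) is b itself if p(b), and otherwise the point e
reached from b, by prefixing the edge to the path. -/
theorem cycProvable_backForm : CycProvable {backForm} := by
  obtain ⟨a, ha⟩ := Sequent.exists_fresh {backForm}
  refine .of_all_mem (Finset.mem_singleton_self _) a ha ?_
  rw [Form.inst]
  obtain ⟨b, hb⟩ := Sequent.exists_fresh
    (insert (.all (backBody.inst (Form.lift ![Tm.cst a]))) {backForm})
  refine .of_all_mem (Finset.mem_insert_self ..) b hb ?_
  rw [backBody_inst]
  refine .of_or_mem (Finset.mem_insert_self ..) (.of_or_mem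
    (A := (goalForm (Tm.cst b)).compl) (B := goalForm (Tm.cst a)) (by simp) ?_)
  refine .of_goalForm_compl_mem (b := b) (by simp) ?_ ?_
  · exact .of_goalForm_mem_of_rel (a := a) (b := b) (by simp) (by simp) (by simp)
  · intro e he Δ hΔ hp hc
    refine .of_goalForm_mem (a := a) (hΔ (by simp)) hp
      (.of_tc_mem_step (Finset.mem_insert_self ..) (Tm.cst b) ?_ ?_)
    · rw [edgeBody_inst]
      exact .of_rel_mem (a := 0) (s := Tm.cst a) (t := Tm.cst b) (by simp)
        (Finset.mem_insert_of_mem (Finset.mem_insert_of_mem (hΔ (by simp))))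
    · exact .of_tc_cotc_mem he (by simp)
        (Finset.mem_insert_of_mem (Finset.mem_insert_of_mem hc))

theorem backForm_compl_inst (a b : ℕ) :
    (backBody.compl.inst (Form.lift ![(Tm.cst a : Tm 0)])).inst ![(Tm.cst b : Tm 0)] =
      .and (.rel (0 : ℕ) (Tm.cst a) (Tm.cst b))
        (.and (goalForm (Tm.cst b)) (goalForm (Tm.cst a)).compl) := by
  rw [Form.compl_inst, Form.compl_inst, backBody_inst]
  rfl

theorem goalForm_onForm_rename (c e x : ℕ) : (SymSubst.rename c e).onForm
    (goalForm (Tm.cst x : Tm 0)) = goalForm (Tm.cst (if x = c then e else x)) := by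
  simp [goalForm, reachBody, edgeBody, SymSubst.onForm, SymSubst.onTm]

theorem backForm_compl_onForm (σ : SymSubst) : σ.onForm backForm.compl = backForm.compl := by
  simp [backForm, backBody, goalForm, reachBody, edgeBody, SymSubst.onForm, SymSubst.onTm,
    Form.compl, Tm.weaken, Language.Term.relabel]

/-- The induction on the path. Instantiating the dual of `backForm` at the edge from 0 to 2 trades
G(0) for G(2); renaming 0 to 2 then identifies the sequent with the initial one. -/
theorem cycProvable_loop : CycProvable {Form.cotc (stepBody 0) (Tm.cst 0) (Tm.cst 1),
    .npred (0 : ℕ) (Tm.cst 1), goalForm (Tm.cst 0), backForm.compl} := by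
  let K (x : ℕ) : Sentence := .cotc (stepBody 0) (Tm.cst x) (Tm.cst 1)
  let P : Sentence := .npred (0 : ℕ) (Tm.cst 1)
  let G (x : ℕ) : Sentence := goalForm (Tm.cst x)
  let C : Sentence := backForm.compl
  let N : Sentence := .nrel (0 : ℕ) (Tm.cst 0) (Tm.cst 2)
  let A : Form 1 := backBody.compl.inst (Form.lift ![(Tm.cst 0 : Tm 0)])
  have hK : (SymSubst.rename 0 2).onForm (K 0) = K 2 := by
    simp [K, SymSubst.onForm, stepBody, SymSubst.onTm]
  have hP : (SymSubst.rename 0 2).onForm P = P := by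
    simp [P, SymSubst.onForm]
  have hG : (SymSubst.rename 0 2).onForm (G 0) = G 2 := goalForm_onForm_rename ..
  have hC : (SymSubst.rename 0 2).onForm C = C := backForm_compl_onForm _
  -- The side premisses close by the edge assumption, by p̄(0) against G(0), or by G(0) against its
  -- dual. The last two steps weaken away what mentions the old point 0 and rename.
  refine CycProvable.of_loop (m := 7)
    ![.cotc {P, G 0, C} (stepBody 0) (Tm.cst 0) (Tm.cst 1) 2,
      .and {K 2, P, G 0, C} N (.npred (0 : ℕ) (Tm.cst 0)),
      .ex {N, K 2, P, G 0, C} (.ex backBody.compl) (Tm.cst 0),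
      .ex {N, K 2, P, G 0, C} A (Tm.cst 2),
      .and {N, K 2, P, G 0, C} (.rel (0 : ℕ) (Tm.cst 0) (Tm.cst 2)) (.and (G 2) (G 0).compl),
      .and {N, K 2, P, G 0, C} (G 2) (G 0).compl,
      .wk {K 2, P, G 2, C} {N, G 0},
      .subst (SymSubst.rename 0 2) {K 0, P, G 0, C}] ![1, 0, 0, 0, 1, 0, 0, 0]
    ![K 0, K 2, K 2, K 2, K 2, K 2, K 2, K 2] ?_ ?_ ?_ ?_ ?_ ?_ ?_
  · intro i
    fin_cases i
    · simp [Step.SideCond, Step.concl, Form.HasConst, edgeBody, Form.compl, P, G, C, stepBody,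
        goalForm, reachBody, backForm, backBody, Tm.weaken, Language.Term.relabel]
      change ¬ (Tm.cst 0 : Tm 0).weaken.HasConst 2
      simp
    all_goals trivial
  · intro i
    fin_cases i <;> simp [Step.IsCut]
  · intro i
    fin_cases i
    · simp [Step.prems, Step.concl, stepBody_inst]
      rfl
    · simp [Step.prems, Step.concl]
      change ({N, K 2, P, G 0, C} : Sequent) = {C, N, K 2, P, G 0, C}
      ext
      simp only [Finset.mem_insert, Finset.mem_singleton]
      tauto
    · simp [Step.prems, Step.concl]
      rfl
    · simp [Step.prems, Step.concl]
      rw [backForm_compl_inst]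
    · simp [Step.prems, Step.concl]
    · simp [Step.prems, Step.concl]
      ext
      simp only [Finset.mem_insert, Finset.mem_singleton]
      tauto
    · simp [Step.prems, Step.concl, hK, hP, hG, hC]
    · rfl
  · intro i
    fin_cases i
    · simp [Step.prems, stepBody_inst]
      refine .of_and_mem (Finset.mem_insert_self ..) ?_ ?_
      · exact .of_goalForm_mem_of_rel (a := 0) (b := 1) (by simp [G]) (by simp) (by simp [P])
      · exact .of_goalForm_mem_of_pred (a := 0) (by simp [G]) (by simp)
    · simp [Step.prems]
      exact .of_goalForm_mem_of_pred (a := 0) (by simp [G]) (by simp)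
    · simp [Step.prems]
    · simp [Step.prems]
    · simp [Step.prems]
      exact .of_rel_mem (a := 0) (s := Tm.cst 0) (t := Tm.cst 2) (by simp) (by simp [N])
    · simp [Step.prems]
      exact .of_goalForm_mem_of_compl_mem (a := 0) (by simp [G]) (by simp [G])
    · simp [Step.prems]
    · simp [Step.prems]
  · intro i
    fin_cases i <;> exact ⟨⟨_, _, _, rfl⟩, by simp [Step.concl, hK, K]⟩
  · intro i j hj
    fin_cases i
    · exact .inr (.inl ⟨_, _, _, _, _, rfl, hj, rfl, rfl⟩)
    rotate_right
    · exact .inr (.inr ⟨_, _, rfl, hK⟩)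
    all_goals exact .inl ⟨by simp [Step.IsSubst], rfl⟩
  · intro j hj
    exact ⟨_, _, _, _, _, rfl, hj, rfl, rfl⟩

/-- The formula that has no cyclic proof without cuts. -/
def counterexample : Sentence :=
  .or (.cotc (stepBody 0) (Tm.cst 0) (Tm.cst 1))
    (.or (.npred (0 : ℕ) (Tm.cst 1)) (goalForm (Tm.cst 0)))

theorem not_cycProvable_counterexample : ¬ CycProvable {counterexample} := by
  -- The constant 1 needs position k to refute p̄(1); on path 1 it is disconnected from 0.
  refine not_cycProvable_of_refuted fun k hk => ⟨fun _ f => if f = 0 then (0, 0) else (1, k), ?_⟩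
  simp only [Finset.mem_singleton, forall_eq, counterexample, goalForm, Tm.weaken_cst]
  exact ⟨⟨rfl, hk.le⟩, rfl, hk.ne, _, rfl, rfl⟩

theorem cycProvable_counterexample_backForm : CycProvable (insert backForm {counterexample}) :=
  cycProvable_backForm.mono (by simp)

theorem cycProvable_counterexample_backForm_compl :
    CycProvable (insert backForm.compl {counterexample}) := by
  refine .of_or_mem (A := .cotc (stepBody 0) (Tm.cst 0) (Tm.cst 1))
    (B := .or (.npred (0 : ℕ) (Tm.cst 1)) (goalForm (Tm.cst 0))) (by simp [counterexample])
    (.of_or_mem (A := .npred (0 : ℕ) (Tm.cst 1)) (B := goalForm (Tm.cst 0)) (by simp)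
      (cycProvable_loop.mono ?_))
  intro
  simp only [Finset.mem_insert, Finset.mem_singleton]
  tauto

end TCL

end

theorem mainTheorem5 :
    (∃ A : TCL.Sentence, TCL.CycProvableWithCut {A} ∧ ¬ TCL.CycProvable {A}) ∧
      ¬ TCL.CutAdmissible := by
  refine ⟨⟨TCL.counterexample, ?_, TCL.not_cycProvable_counterexample⟩, fun h =>
    TCL.not_cycProvable_counterexample (h _ _ TCL.cycProvable_counterexample_backForm
      TCL.cycProvable_counterexample_backForm_compl)⟩
  refine TCL.CycProvableWithCut.step (.cut {TCL.counterexample} TCL.backForm) trivial ?_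
  simpa [TCL.Step.prems] using ⟨TCL.cycProvable_counterexample_backForm.withCut,
    TCL.cycProvable_counterexample_backForm_compl.withCut⟩
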